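/- Let $(M,\varphi,\xi,\eta,g)$ be a paracontact metric manifold of dimension $2n+1$. That is, $M$ is a smooth manifold with a smooth $(1,1)$-tensor field $\varphi$, vector field $\xi$, 1-form $\eta$ and pseudo-Riemannian metric $g$ such that $\varphi\xi=0$, $\eta\circ\varphi=0$, $\eta(\xi)=1$, $\varphi^2=\mathrm{id}-\eta\otimes\xi$, the eigenspaces of $\varphi|_{\ker\eta}$ for the eigenvalues $1$ and $-1$ both have dimension $n$ at every point, $g(\varphi X,\varphi Y)=-g(X,Y)+\eta(X)\eta(Y)$, and $g(X,\varphi Y)=d\eta(X,Y)$, where $d\eta(X,Y)=\tfrac12\bigl(X\eta(Y)-Y\eta(X)-\eta([X,Y])\bigr)$. Let $\nabla$ be the Levi-Civita connection of $g$, with curvature $R(X,Y)=[\nabla_X,\nabla_Y]-\nabla_{[X,Y]}$, $R(\partial_i,\partial_j)\partial_k=R^l_{ijk}\partial_l$, $R_{ijkl}=R^s_{ijk}g_{sl}$, $Ric_{jk}=R^i_{ijk}$, $scal=g^{jk}Ric_{jk}$, and put $$Ric^*_{ij}=g^{ps}R_{pilk}\varphi^l_j\varphi^k_s,\qquad scal^*=g^{ij}Ric^*_{ij},\qquad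 h=\tfrac12\mathcal L_\xi\varphi,$$ $$h_{ij}=g_{ir}h^r_j,\qquad \varphi_{ij}=g_{ir}\varphi^r_j,\qquad P_{rsi}=\nabla_r\varphi_{si}-\eta_i g_{rs}+\eta_s g_{ri}.$$ Let $|h|^2=g^{ir}g^{js}h_{ij}h_{rs}$, and let $|\nabla\varphi|^2$ and $|P|^2$ be the full contractions with $g$ of the squares of the 3-tensors $\nabla_r\varphi_{si}$ and $P_{rsi}$. Then, at every point, $$scal+scal^*+4n^2=|h|^2+\tfrac12|\nabla\varphi|^2-2n,\qquad |P|^2=|\nabla\varphi|^2-4n.$$ If moreover the manifold is paraSasakian, i.e. the structure is normal: $[\varphi X,\varphi Y]-\varphi[\varphi X,Y]-\varphi[X,\varphi Y]+\varphi^2[X,Y]-2d\eta(X,Y)\xi=0$ for all vector fields $X,Y$, then $scal+scal^*+4n^2=0$. -/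

import Mathlib

open scoped Manifold ContDiff Bundle

noncomputable section

namespace Paracontact

/-! ### Tensor calculus on an open subset of `ℝ^m` -/

/-- Coordinate expressions, on `ℝ^m`, of a bilinear form `g`, an endomorphism field `φ`,
a vector field `ξ` and a 1-form `η`. -/
structure CoordFields (m : ℕ) where
  g : EuclideanSpace ℝ (Fin m) →
    EuclideanSpace ℝ (Fin m) →L[ℝ] EuclideanSpace ℝ (Fin m) →L[ℝ] ℝ
  φ : EuclideanSpace ℝ (Fin m) → EuclideanSpace ℝ (Fin m) →L[ℝ] EuclideanSpace ℝ (Fin m)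
  ξ : EuclideanSpace ℝ (Fin m) → EuclideanSpace ℝ (Fin m)
  η : EuclideanSpace ℝ (Fin m) → EuclideanSpace ℝ (Fin m) →L[ℝ] ℝ

/-- The coordinate vector `∂_i`. -/
def coordVec {m : ℕ} (i : Fin m) : EuclideanSpace ℝ (Fin m) := EuclideanSpace.single i (1 : ℝ)

/-- The partial derivative `∂_i f`. -/
def partialD {m : ℕ} (i : Fin m) (f : EuclideanSpace ℝ (Fin m) → ℝ)
    (y : EuclideanSpace ℝ (Fin m)) : ℝ :=
  fderiv ℝ f y (coordVec i)

namespace CoordFields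

/-- `g_{ij}`. -/
def gLow {m : ℕ} (T : CoordFields m) (y : EuclideanSpace ℝ (Fin m)) :
    Matrix (Fin m) (Fin m) ℝ :=
  Matrix.of fun i j => T.g y (coordVec i) (coordVec j)

/-- `g^{ij}`, the inverse matrix of `g_{ij}`. -/
def gUp {m : ℕ} (T : CoordFields m) (y : EuclideanSpace ℝ (Fin m)) :
    Matrix (Fin m) (Fin m) ℝ :=
  (T.gLow y)⁻¹

/-- `φ^i_j`. -/
def phi {m : ℕ} (T : CoordFields m) (i j : Fin m) (y : EuclideanSpace ℝ (Fin m)) : ℝ :=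
  T.φ y (coordVec j) i

/-- `η_i`. -/
def etaLow {m : ℕ} (T : CoordFields m) (i : Fin m) (y : EuclideanSpace ℝ (Fin m)) : ℝ :=
  T.η y (coordVec i)

/-- The Christoffel symbols `Γ^k_{ij}` of the Levi-Civita connection of `g`. -/
def christoffel {m : ℕ} (T : CoordFields m) (k i j : Fin m)
    (y : EuclideanSpace ℝ (Fin m)) : ℝ :=
  1 / 2 * ∑ l, T.gUp y k l *
    (partialD i (fun z => T.gLow z j l) y + partialD j (fun z => T.gLow z i l) y
      - partialD l (fun z => T.gLow z i j) y)

/-- The curvature `R^l_{ijk}`, where `R(∂_i, ∂_j) ∂_k = R^l_{ijk} ∂_l` and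
`R(X, Y) = [∇_X, ∇_Y] - ∇_{[X, Y]}`. -/
def curv {m : ℕ} (T : CoordFields m) (l i j k : Fin m) (y : EuclideanSpace ℝ (Fin m)) : ℝ :=
  partialD i (T.christoffel l j k) y - partialD j (T.christoffel l i k) y
    + ∑ s, (T.christoffel l i s y * T.christoffel s j k y
      - T.christoffel l j s y * T.christoffel s i k y)

/-- `R_{ijkl} = g(R(∂_i, ∂_j) ∂_k, ∂_l)`. -/
def curvLow {m : ℕ} (T : CoordFields m) (i j k l : Fin m) (y : EuclideanSpace ℝ (Fin m)) : ℝ :=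
  ∑ s, T.curv s i j k y * T.gLow y s l

/-- The Ricci tensor `Ric_{jk} = R^i_{ijk}`. -/
def ricci {m : ℕ} (T : CoordFields m) (j k : Fin m) (y : EuclideanSpace ℝ (Fin m)) : ℝ :=
  ∑ i, T.curv i i j k y

/-- The scalar curvature `g^{jk} Ric_{jk}`. -/
def scal {m : ℕ} (T : CoordFields m) (y : EuclideanSpace ℝ (Fin m)) : ℝ :=
  ∑ j, ∑ k, T.gUp y j k * T.ricci j k y

/-- The *-Ricci tensor `Ric*_{ij} = g^{ps} R_{pilk} φ^l_j φ^k_s`. -/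
def ricciStar {m : ℕ} (T : CoordFields m) (i j : Fin m) (y : EuclideanSpace ℝ (Fin m)) : ℝ :=
  ∑ p, ∑ s, ∑ l, ∑ k, T.gUp y p s * T.curvLow p i l k y * T.phi l j y * T.phi k s y

/-- The *-scalar curvature `g^{ij} Ric*_{ij}`. -/
def scalStar {m : ℕ} (T : CoordFields m) (y : EuclideanSpace ℝ (Fin m)) : ℝ :=
  ∑ i, ∑ j, T.gUp y i j * T.ricciStar i j y

/-- The components `h^i_j` of `h = (1/2) L_ξ φ`, where `(L_ξ φ) X = [ξ, φ X] - φ [ξ, X]`;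
here `X` is the coordinate vector field `∂_j`. -/
def hUp {m : ℕ} (T : CoordFields m) (i j : Fin m) (y : EuclideanSpace ℝ (Fin m)) : ℝ :=
  1 / 2 * (VectorField.lieBracket ℝ T.ξ (fun z => T.φ z (coordVec j)) y
    - T.φ y (VectorField.lieBracket ℝ T.ξ (fun _ => coordVec j) y)) i

/-- `h_{ij} = g_{ir} h^r_j`. -/
def hLow {m : ℕ} (T : CoordFields m) (i j : Fin m) (y : EuclideanSpace ℝ (Fin m)) : ℝ :=
  ∑ r, T.gLow y i r * T.hUp r j y

/-- `|h|² = g^{ir} g^{js} h_{ij} h_{rs}`. -/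
def normSqH {m : ℕ} (T : CoordFields m) (y : EuclideanSpace ℝ (Fin m)) : ℝ :=
  ∑ i, ∑ j, ∑ r, ∑ s, T.gUp y i r * T.gUp y j s * T.hLow i j y * T.hLow r s y

/-- The covariant derivative `∇_r φ^i_j`. -/
def nablaPhi {m : ℕ} (T : CoordFields m) (r i j : Fin m) (y : EuclideanSpace ℝ (Fin m)) : ℝ :=
  partialD r (T.phi i j) y
    + ∑ s, (T.christoffel i r s y * T.phi s j y - T.christoffel s r j y * T.phi i s y)

/-- `∇_r φ_{si} = g_{sk} ∇_r φ^k_i`. -/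
def nablaPhiLow {m : ℕ} (T : CoordFields m) (r s i : Fin m)
    (y : EuclideanSpace ℝ (Fin m)) : ℝ :=
  ∑ k, T.gLow y s k * T.nablaPhi r k i y

/-- The square norm `g^{ra} g^{sb} g^{ic} A_{rsi} A_{abc}` (possibly negative) of a
covariant 3-tensor. -/
def normSq₃ {m : ℕ} (T : CoordFields m) (A : Fin m → Fin m → Fin m → ℝ)
    (y : EuclideanSpace ℝ (Fin m)) : ℝ :=
  ∑ r, ∑ s, ∑ i, ∑ a, ∑ b, ∑ c,
    T.gUp y r a * T.gUp y s b * T.gUp y i c * A r s i * A a b c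

/-- `|∇φ|²`. -/
def normSqNablaPhi {m : ℕ} (T : CoordFields m) (y : EuclideanSpace ℝ (Fin m)) : ℝ :=
  T.normSq₃ (fun r s i => T.nablaPhiLow r s i y) y

/-- `P_{rsi} = ∇_r φ_{si} - η_i g_{rs} + η_s g_{ri}`. -/
def tensorP {m : ℕ} (T : CoordFields m) (r s i : Fin m) (y : EuclideanSpace ℝ (Fin m)) : ℝ :=
  T.nablaPhiLow r s i y - T.etaLow i y * T.gLow y r s + T.etaLow s y * T.gLow y r i

/-- `|P|²`. -/
def normSqP {m : ℕ} (T : CoordFields m) (y : EuclideanSpace ℝ (Fin m)) : ℝ :=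
  T.normSq₃ (fun r s i => T.tensorP r s i y) y

/-- `dη(X, Y) = (1/2) (X η(Y) - Y η(X) - η([X, Y]))`. -/
def dEta {m : ℕ} (T : CoordFields m) (X Y : EuclideanSpace ℝ (Fin m) → EuclideanSpace ℝ (Fin m))
    (y : EuclideanSpace ℝ (Fin m)) : ℝ :=
  1 / 2 * (fderiv ℝ (fun z => T.η z (Y z)) y (X y) - fderiv ℝ (fun z => T.η z (X z)) y (Y y)
    - T.η y (VectorField.lieBracket ℝ X Y y))

/-- The Nijenhuis tensor `N_φ(X, Y) = [φX, φY] - φ[φX, Y] - φ[X, φY] + φ²[X, Y]`. -/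
def nijenhuis {m : ℕ} (T : CoordFields m)
    (X Y : EuclideanSpace ℝ (Fin m) → EuclideanSpace ℝ (Fin m))
    (y : EuclideanSpace ℝ (Fin m)) : EuclideanSpace ℝ (Fin m) :=
  VectorField.lieBracket ℝ (fun z => T.φ z (X z)) (fun z => T.φ z (Y z)) y
    - T.φ y (VectorField.lieBracket ℝ (fun z => T.φ z (X z)) Y y)
    - T.φ y (VectorField.lieBracket ℝ X (fun z => T.φ z (Y z)) y)
    + T.φ y (T.φ y (VectorField.lieBracket ℝ X Y y))

end CoordFields

/-! ### Almost paracontact metric manifolds -/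

/-- An almost paracontact structure `(φ, ξ, η)` on a smooth manifold of dimension `2n + 1`. -/
structure AlmostParacontact (n : ℕ) (M : Type*) [TopologicalSpace M]
    [ChartedSpace (EuclideanSpace ℝ (Fin (2 * n + 1))) M] [IsManifold (𝓡 (2 * n + 1)) ∞ M] where
  φ : Π x : M, TangentSpace (𝓡 (2 * n + 1)) x →L[ℝ] TangentSpace (𝓡 (2 * n + 1)) x
  ξ : Π x : M, TangentSpace (𝓡 (2 * n + 1)) x
  η : Π x : M, TangentSpace (𝓡 (2 * n + 1)) x →L[ℝ] ℝ
  smooth_φ : ContMDiff (𝓡 (2 * n + 1)) ((𝓡 (2 * n + 1)).prod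
      𝓘(ℝ, EuclideanSpace ℝ (Fin (2 * n + 1)) →L[ℝ] EuclideanSpace ℝ (Fin (2 * n + 1)))) ∞
    (fun x => Bundle.TotalSpace.mk'
      (EuclideanSpace ℝ (Fin (2 * n + 1)) →L[ℝ] EuclideanSpace ℝ (Fin (2 * n + 1))) x (φ x))
  smooth_ξ : ContMDiff (𝓡 (2 * n + 1)) (𝓡 (2 * n + 1)).tangent ∞
    (fun x => (Bundle.TotalSpace.mk' (EuclideanSpace ℝ (Fin (2 * n + 1))) x (ξ x) :
      TangentBundle (𝓡 (2 * n + 1)) M))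
  smooth_η : ContMDiff (𝓡 (2 * n + 1)) ((𝓡 (2 * n + 1)).prod
      𝓘(ℝ, EuclideanSpace ℝ (Fin (2 * n + 1)) →L[ℝ] ℝ)) ∞
    (fun x => Bundle.TotalSpace.mk' (EuclideanSpace ℝ (Fin (2 * n + 1)) →L[ℝ] ℝ) x (η x))
  φ_ξ : ∀ x, φ x (ξ x) = 0
  η_φ : ∀ x v, η x (φ x v) = 0
  η_ξ : ∀ x, η x (ξ x) = 1
  φ_φ : ∀ x v, φ x (φ x v) = v - η x v • ξ x
  /-- On `ker η` the eigenspaces of `φ` for `1` and `-1` have equal dimension `n`. -/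
  finrank_pos : ∀ x, Module.finrank ℝ
    ↥(Module.End.eigenspace (φ x).toLinearMap 1 ⊓ LinearMap.ker (η x).toLinearMap) = n
  finrank_neg : ∀ x, Module.finrank ℝ
    ↥(Module.End.eigenspace (φ x).toLinearMap (-1) ⊓ LinearMap.ker (η x).toLinearMap) = n

/-- An almost paracontact metric structure: an almost paracontact structure with a compatible
pseudo-Riemannian metric `g`. -/
structure AlmostParacontactMetric (n : ℕ) (M : Type*) [TopologicalSpace M]
    [ChartedSpace (EuclideanSpace ℝ (Fin (2 * n + 1))) M] [IsManifold (𝓡 (2 * n + 1)) ∞ M]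
    extends AlmostParacontact n M where
  g : Π x : M, TangentSpace (𝓡 (2 * n + 1)) x →L[ℝ] TangentSpace (𝓡 (2 * n + 1)) x →L[ℝ] ℝ
  smooth_g : ContMDiff (𝓡 (2 * n + 1)) ((𝓡 (2 * n + 1)).prod
      𝓘(ℝ, EuclideanSpace ℝ (Fin (2 * n + 1)) →L[ℝ]
        EuclideanSpace ℝ (Fin (2 * n + 1)) →L[ℝ] ℝ)) ∞
    (fun x => Bundle.TotalSpace.mk' (EuclideanSpace ℝ (Fin (2 * n + 1)) →L[ℝ]
      EuclideanSpace ℝ (Fin (2 * n + 1)) →L[ℝ] ℝ) x (g x))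
  g_symm : ∀ x v w, g x v w = g x w v
  g_nondegenerate : ∀ x v, (∀ w, g x v w = 0) → v = 0
  g_compatible : ∀ x v w, g x (φ x v) (φ x w) = - g x v w + η x v * η x w

namespace AlmostParacontactMetric

/-- The structure tensors read in a chart `e`: the vector `u ∈ ℝ^{2n+1}` at `y = e(x)`
represents the tangent vector `d(e⁻¹)_y u` at `x`. -/
def inChart {n : ℕ} {M : Type*} [TopologicalSpace M]
    [ChartedSpace (EuclideanSpace ℝ (Fin (2 * n + 1))) M] [IsManifold (𝓡 (2 * n + 1)) ∞ M]
    (S : AlmostParacontactMetric n M)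
    (e : OpenPartialHomeomorph M (EuclideanSpace ℝ (Fin (2 * n + 1)))) :
    CoordFields (2 * n + 1) where
  g y := ((mfderiv (𝓡 (2 * n + 1)) (𝓡 (2 * n + 1)) e.symm y).precomp ℝ).comp
    ((S.g (e.symm y)).comp (mfderiv (𝓡 (2 * n + 1)) (𝓡 (2 * n + 1)) e.symm y))
  φ y := (mfderiv (𝓡 (2 * n + 1)) (𝓡 (2 * n + 1)) e (e.symm y)).comp
    ((S.φ (e.symm y)).comp (mfderiv (𝓡 (2 * n + 1)) (𝓡 (2 * n + 1)) e.symm y))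
  ξ y := mfderiv (𝓡 (2 * n + 1)) (𝓡 (2 * n + 1)) e (e.symm y) (S.ξ (e.symm y))
  η y := (S.η (e.symm y)).comp (mfderiv (𝓡 (2 * n + 1)) (𝓡 (2 * n + 1)) e.symm y)

/-- `M` is a paracontact metric manifold: `g(X, φY) = dη(X, Y)` for all smooth vector fields `X`,
`Y` on the domain of any chart. -/
def IsParacontact {n : ℕ} {M : Type*} [TopologicalSpace M]
    [ChartedSpace (EuclideanSpace ℝ (Fin (2 * n + 1))) M] [IsManifold (𝓡 (2 * n + 1)) ∞ M]
    (S : AlmostParacontactMetric n M) : Prop :=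
  ∀ e ∈ IsManifold.maximalAtlas (𝓡 (2 * n + 1)) ∞ M,
    ∀ X Y : EuclideanSpace ℝ (Fin (2 * n + 1)) → EuclideanSpace ℝ (Fin (2 * n + 1)),
      ContDiffOn ℝ ∞ X e.target → ContDiffOn ℝ ∞ Y e.target → ∀ y ∈ e.target,
        (S.inChart e).g y (X y) ((S.inChart e).φ y (Y y)) = (S.inChart e).dEta X Y y

/-- The structure is normal: `N_φ(X, Y) - 2 dη(X, Y) ξ = 0` for all smooth vector fields `X`, `Y`
on the domain of any chart. -/
def IsNormal {n : ℕ} {M : Type*} [TopologicalSpace M]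
    [ChartedSpace (EuclideanSpace ℝ (Fin (2 * n + 1))) M] [IsManifold (𝓡 (2 * n + 1)) ∞ M]
    (S : AlmostParacontactMetric n M) : Prop :=
  ∀ e ∈ IsManifold.maximalAtlas (𝓡 (2 * n + 1)) ∞ M,
    ∀ X Y : EuclideanSpace ℝ (Fin (2 * n + 1)) → EuclideanSpace ℝ (Fin (2 * n + 1)),
      ContDiffOn ℝ ∞ X e.target → ContDiffOn ℝ ∞ Y e.target → ∀ y ∈ e.target,
        (S.inChart e).nijenhuis X Y y - (2 * (S.inChart e).dEta X Y y) • (S.inChart e).ξ y = 0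

/-- A paraSasakian manifold is a normal paracontact metric manifold. -/
def IsParaSasakian {n : ℕ} {M : Type*} [TopologicalSpace M]
    [ChartedSpace (EuclideanSpace ℝ (Fin (2 * n + 1))) M] [IsManifold (𝓡 (2 * n + 1)) ∞ M]
    (S : AlmostParacontactMetric n M) : Prop :=
  S.IsParacontact ∧ S.IsNormal

end AlmostParacontactMetric

end Paracontact

end

/-!
The identities are proved in a chart, at one point at a time, with tensors written as matrices in
the coordinate frame. Write `S = ½ L_ξ g`, so that `∇_r η_i = φ_{ri} + S_{ri}`.

First-order facts. Since `φ_{ij} = dη_{ij}` is closed, `∇_r φ_{si}` has vanishing cyclic sum.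
Contracting this with `φ^{js}`, and using that `φ_{js} φ^{js}` is constant, gives
`φ^{js} ∇_s φ^i_j = 0` (`IsContactJet.sum_nabla_phi_raised`). The derivative of
`φ² = 1 - η ⊗ ξ` turns this into `∇_r φ^r_j = 2n η_j` (`IsContactJet.div_phi`). Also
`L_ξ dη = 0` reads `h_{ij} = -S_{ir} φ^r_j` (`IsContactJet.low_hMat`), whence `div ξ = 0` and
`|h|² = 2n - tr((∇ξ)²)`. Expanding the square, `|P|² = |∇φ|² - 4n`
(`IsContactJet.norm_tensorP`).

Second-order facts. The Ricci identity for `ξ` gives `Ric(ξ, ξ) = -tr((∇ξ)²) = |h|² - 2n`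
(`CoordFields.IsParacontactOn.ricci_xi_xi`). The Ricci identity
`∇_r ∇_s φ - ∇_s ∇_r φ = [R_{rs}, φ]`, contracted over `r` and the upper index and with `φ^{js}`,
has right-hand side `scal - Ric(ξ, ξ) + scal*`. By the divergence formulas its left-hand side is
`-∇_r φ^{js} ∇_s φ^r_j - 2n φ^{js} ∇_s η_j = ½ |∇φ|² - 4n²`, the first term again by the cyclic
identity (`CoordFields.IsParacontactOn.scal_add_scalStar_sub_ricci`). Adding `Ric(ξ, ξ)` gives
the formula.

If the structure is normal, the contraction of the normality condition with `ξ` gives `h = 0`;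
then `S = 0` and `∇_ξ φ = 0`, and the cyclic permutations of the normality condition can be
solved for `∇φ`, with the result `P = 0` (`IsContactJet.low_nabla_phi_of_normal`). So
`|∇φ|² = 4n` and the right-hand side of the formula vanishes.
-/

namespace Paracontact

open Matrix

/-! ### Pointwise algebra of the first-order data -/

section Pointwise

variable {ι : Type*} [Fintype ι]

/-- The `r`-th column of a matrix, as a column matrix. -/
def column (A : Matrix ι ι ℝ) (r : ι) : Matrix ι Unit ℝ := Matrix.of fun i _ => A i r

/-- `∇_ξ φ`. -/
def nablaXi (X : Matrix ι Unit ℝ) (N : ι → Matrix ι ι ℝ) : Matrix ι ι ℝ := ∑ s, X s () • N s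

/-- The operator `h = ½ L_ξ φ = ½ (∇_ξ φ - (∇ξ) φ + φ (∇ξ))`. -/
noncomputable def hMat (Φ : Matrix ι ι ℝ) (X : Matrix ι Unit ℝ) (N : ι → Matrix ι ι ℝ)
    (A : Matrix ι ι ℝ) : Matrix ι ι ℝ :=
  (1 / 2 : ℝ) • (nablaXi X N - A * Φ + Φ * A)

/-- The symmetric part `½ L_ξ g` of `∇η`. -/
def symPart (G Φ A : Matrix ι ι ℝ) : Matrix ι ι ℝ := G * A + G * Φ

/-- The trace `g^{ir} g^{js} b_{ij} b_{rs}` as a matrix trace. -/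
theorem sum_norm_sq (H B : Matrix ι ι ℝ) :
    ∑ i, ∑ j, ∑ r, ∑ s, H i r * H j s * B i j * B r s = (H * B * Hᵀ * Bᵀ).trace := by
  simp only [Matrix.trace, Matrix.diag_apply, Matrix.mul_apply, Finset.sum_mul,
    Matrix.transpose_apply]
  refine Finset.sum_congr rfl fun i _ => Finset.sum_congr rfl fun j _ => ?_
  rw [Finset.sum_comm]
  refine Finset.sum_congr rfl fun r _ => Finset.sum_congr rfl fun s _ => ?_
  ring

variable [DecidableEq ι]

/-- The first-order data of a paracontact metric structure at a point, in coordinates, with the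
relations between them: `G = (g_{ij})`, `H = (g^{ij})`, `Φ = (φ^i_j)`, the column `X = (ξ^i)`
(so that the row `Xᵀ * G` is `η`), `N r = (∇_r φ^i_j)` and `A = (∇_r ξ^i)` with row index `i`
and column index `r`. The dimension `2n + 1` is the number of indices, so that `2n` appears below as
`Fintype.card ι - 1`. -/
structure IsContactJet (G H Φ : Matrix ι ι ℝ) (X : Matrix ι Unit ℝ) (N : ι → Matrix ι ι ℝ)
    (A : Matrix ι ι ℝ) : Prop where
  symm : Gᵀ = G
  mul_inv : G * H = 1
  phi_xi : Φ * X = 0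
  eta_xi : Xᵀ * G * X = 1
  phi_skew : Φᵀ * G = -(G * Φ)
  phi_sq : Φ * Φ = 1 - X * (Xᵀ * G)
  nabla_skew : ∀ r, (N r)ᵀ * G = -(G * N r)
  nabla_phi_sq : ∀ r, N r * Φ + Φ * N r =
    -(column A r * (Xᵀ * G)) - X * ((column A r)ᵀ * G)
  nabla_phi_xi : ∀ r, N r * X = -(Φ * column A r)
  eta_nabla_xi : Xᵀ * G * A = 0
  nabla_eta_skew : G * A - Aᵀ * G = -(2 : ℝ) • (G * Φ)
  cyclic : ∀ r s i, (G * N r) s i + (G * N s) i r + (G * N i) r s = 0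

namespace IsContactJet

variable {G H Φ A : Matrix ι ι ℝ} {X : Matrix ι Unit ℝ} {N : ι → Matrix ι ι ℝ}
  (J : IsContactJet G H Φ X N A)

include J

theorem inv_mul : H * G = 1 := mul_eq_one_comm.mp J.mul_inv

theorem inv_symm : Hᵀ = H := by
  calc Hᵀ = Hᵀ * (G * H) := by rw [J.mul_inv, Matrix.mul_one]
    _ = (G * H)ᵀ * H := by rw [Matrix.transpose_mul, J.symm, Matrix.mul_assoc]
    _ = H := by rw [J.mul_inv, Matrix.transpose_one, Matrix.one_mul]

theorem inv_mul_cancel {κ : Type*} (C : Matrix ι κ ℝ) : H * (G * C) = C := by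
  rw [← Matrix.mul_assoc, J.inv_mul, Matrix.one_mul]

theorem mul_inv_cancel {κ : Type*} (C : Matrix ι κ ℝ) : G * (H * C) = C := by
  rw [← Matrix.mul_assoc, J.mul_inv, Matrix.one_mul]

theorem eta_mul_inv : Xᵀ * G * H = Xᵀ := by rw [Matrix.mul_assoc, J.mul_inv, Matrix.mul_one]

theorem inv_mul_skew {B : Matrix ι ι ℝ} (h : Bᵀ * G = -(G * B)) : (B * H)ᵀ = -(B * H) := by
  calc (B * H)ᵀ = H * (Bᵀ * G) * H := by
        rw [Matrix.transpose_mul, J.inv_symm]; simp only [Matrix.mul_assoc]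
        rw [J.mul_inv, Matrix.mul_one]
    _ = -(B * H) := by
        rw [h, Matrix.mul_neg, J.inv_mul_cancel, Matrix.neg_mul]

theorem inv_mul_transpose : H * Φᵀ = -(Φ * H) := by
  rw [← J.inv_mul_skew J.phi_skew, Matrix.transpose_mul, J.inv_symm]

theorem low_skew {B : Matrix ι ι ℝ} (h : Bᵀ * G = -(G * B)) : (G * B)ᵀ = -(G * B) := by
  rw [Matrix.transpose_mul, J.symm, h]

theorem low_skew_apply (r s i : ι) : (G * N r) s i = -(G * N r) i s := by
  have := congrFun (congrFun (J.low_skew (J.nabla_skew r)) i) s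
  simpa using this

/-- The integral curves of `ξ` are geodesics. -/
theorem nabla_xi_xi : A * X = 0 := by
  have h1 : G * A = Aᵀ * G + -(2 : ℝ) • (G * Φ) := by rw [← J.nabla_eta_skew]; abel
  have h2 : Aᵀ * G * X = 0 := by
    have := congrArg Matrix.transpose J.eta_nabla_xi
    simpa [Matrix.transpose_mul, J.symm, Matrix.mul_assoc] using this
  calc A * X = H * (G * A * X) := by rw [Matrix.mul_assoc, J.inv_mul_cancel]
    _ = 0 := by
      rw [h1, Matrix.add_mul, h2, Matrix.smul_mul, Matrix.mul_assoc, J.phi_xi]; simp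

theorem symPart_symm : (symPart G Φ A)ᵀ = symPart G Φ A := by
  have h1 : G * A = Aᵀ * G + -(2 : ℝ) • (G * Φ) := by rw [← J.nabla_eta_skew]; abel
  rw [symPart, Matrix.transpose_add, Matrix.transpose_mul, Matrix.transpose_mul, J.symm,
    J.phi_skew, h1]
  module

theorem symPart_xi : symPart G Φ A * X = 0 := by
  rw [symPart, Matrix.add_mul, Matrix.mul_assoc, Matrix.mul_assoc, J.nabla_xi_xi, J.phi_xi]
  simp

theorem xi_symPart : Xᵀ * symPart G Φ A = 0 := by
  have := congrArg Matrix.transpose J.symPart_xi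
  rwa [Matrix.transpose_mul, J.symPart_symm, Matrix.transpose_zero] at this

theorem nabla_xi_eq : A = H * symPart G Φ A - Φ := by
  rw [symPart, Matrix.mul_add, J.inv_mul_cancel, J.inv_mul_cancel]; abel

theorem trace_phi_sq : (Φ * Φ).trace = Fintype.card ι - 1 := by
  rw [J.phi_sq, Matrix.trace_sub, Matrix.trace_one, Matrix.trace_mul_comm, J.eta_xi]
  simp

theorem trace_phi : Φ.trace = 0 := by
  have : Φ.trace = -Φ.trace := by
    calc Φ.trace = (G * (H * Φᵀ)).trace := by rw [J.mul_inv_cancel, Matrix.trace_transpose]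
      _ = -(G * (Φ * H)).trace := by rw [J.inv_mul_transpose, Matrix.mul_neg, Matrix.trace_neg]
      _ = -Φ.trace := by
        rw [Matrix.trace_mul_comm, Matrix.mul_assoc, J.inv_mul, Matrix.mul_one]
  linarith

theorem trace_phi_inv_symm {S : Matrix ι ι ℝ} (hS : Sᵀ = S) : (Φ * H * S).trace = 0 := by
  have : (Φ * H * S).trace = -(Φ * H * S).trace := by
    calc (Φ * H * S).trace = (S * (H * Φᵀ)).trace := by
          rw [← Matrix.trace_transpose]; simp [Matrix.transpose_mul, hS, J.inv_symm]
      _ = _ := by rw [J.inv_mul_transpose, Matrix.mul_neg, Matrix.trace_neg,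
                    Matrix.trace_mul_comm]
  linarith

theorem trace_phi_nabla_xi : (Φ * A).trace = 1 - Fintype.card ι := by
  rw [J.nabla_xi_eq, Matrix.mul_sub, Matrix.trace_sub, ← Matrix.mul_assoc,
    J.trace_phi_inv_symm J.symPart_symm, J.trace_phi_sq]
  ring

theorem nabla_phi_trace (r : ι) : (N r * Φ).trace = 0 := by
  have h := congrArg Matrix.trace (J.nabla_phi_sq r)
  have h1 : Xᵀ * G * column A r = 0 := by
    ext a b
    exact congrFun (congrFun J.eta_nabla_xi a) r
  have h2 : (column A r)ᵀ * G * X = 0 := by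
    have := congrArg Matrix.transpose h1
    simpa [Matrix.transpose_mul, J.symm, Matrix.mul_assoc] using this
  rw [Matrix.trace_add, Matrix.trace_sub, Matrix.trace_neg, Matrix.trace_mul_comm Φ,
    Matrix.trace_mul_comm _ (Xᵀ * G), h1, Matrix.trace_mul_comm X, h2] at h
  simp at h
  linarith

theorem low_nablaXi : G * nablaXi X N = (G * (Φ * A))ᵀ - G * (Φ * A) := by
  have key : ∀ i j, ∑ s, (G * N i) j s * X s () = -(G * (Φ * A)) j i := by
    intro i j
    have : (G * N i * X) j () = -(G * (Φ * column A i)) j () := by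
      rw [Matrix.mul_assoc, J.nabla_phi_xi i, Matrix.mul_neg]; rfl
    simpa [Matrix.mul_apply, column] using this
  ext i j
  have h1 : (G * nablaXi X N) i j = ∑ s, (G * N s) i j * X s () := by
    rw [nablaXi, Matrix.mul_sum, Matrix.sum_apply]
    simp [mul_comm]
  rw [h1, Matrix.sub_apply, Matrix.transpose_apply]
  have h2 : ∀ s, (G * N s) i j = (G * N j) i s - (G * N i) j s := fun s => by
    have := J.cyclic s i j
    rw [J.low_skew_apply j s i] at this
    linarith
  simp only [h2, sub_mul, Finset.sum_sub_distrib, key]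
  ring

/-- Lowering an index, `h_{ij} = -½ (L_ξ g)_{ir} φ^r_j`; this is `L_ξ (dη) = 0`. -/
theorem low_hMat : G * hMat Φ X N A = -(symPart G Φ A * Φ) := by
  have h1 : Aᵀ * G = G * A + (2 : ℝ) • (G * Φ) := by
    have := J.nabla_eta_skew
    rw [sub_eq_iff_eq_add] at this
    rw [this]; module
  have h2 : (G * (Φ * A))ᵀ = -(G * A * Φ) - (2 : ℝ) • (G * Φ * Φ) := by
    rw [Matrix.transpose_mul, Matrix.transpose_mul, J.symm, Matrix.mul_assoc, J.phi_skew,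
      Matrix.mul_neg, ← Matrix.mul_assoc, h1, Matrix.add_mul, Matrix.smul_mul]
    abel
  rw [hMat, Matrix.mul_smul, Matrix.mul_add, Matrix.mul_sub, J.low_nablaXi, h2, symPart,
    Matrix.add_mul, ← Matrix.mul_assoc G A]
  module

theorem hMat_eq : hMat Φ X N A = -(H * symPart G Φ A * Φ) := by
  rw [← J.inv_mul_cancel (hMat Φ X N A), J.low_hMat, Matrix.mul_neg, Matrix.mul_assoc]

theorem symPart_phi_phi : symPart G Φ A * Φ * Φ = symPart G Φ A := by
  rw [Matrix.mul_assoc, J.phi_sq, Matrix.mul_sub, Matrix.mul_one, ← Matrix.mul_assoc,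
    J.symPart_xi, Matrix.zero_mul, sub_zero]

/-- `ξ` is divergence free: `tr(φ h) = 0` because `tr φ²` is constant. -/
theorem trace_nabla_xi : A.trace = 0 := by
  have h1 : (hMat Φ X N A * Φ).trace = 0 := by
    have h2 : (nablaXi X N * Φ).trace = 0 := by
      rw [nablaXi, Finset.sum_mul, Matrix.trace_sum]
      refine Finset.sum_eq_zero fun s _ => ?_
      rw [Matrix.smul_mul, Matrix.trace_smul, J.nabla_phi_trace, smul_zero]
    rw [hMat, Matrix.smul_mul, Matrix.trace_smul, Matrix.add_mul, Matrix.sub_mul,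
      Matrix.trace_add, Matrix.trace_sub, h2, Matrix.trace_mul_comm (Φ * A) Φ,
      ← Matrix.mul_assoc Φ Φ A, Matrix.trace_mul_comm (Φ * Φ) A, Matrix.mul_assoc A Φ Φ]
    simp
  have h3 : hMat Φ X N A * Φ = -(H * symPart G Φ A) := by
    rw [J.hMat_eq, Matrix.neg_mul, Matrix.mul_assoc, Matrix.mul_assoc,
      ← Matrix.mul_assoc (symPart G Φ A), J.symPart_phi_phi]
  rw [h3, Matrix.trace_neg, neg_eq_zero] at h1
  rw [J.nabla_xi_eq, Matrix.trace_sub, h1, J.trace_phi, sub_zero]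

theorem trace_nabla_xi_sq : (A * A).trace =
    (H * symPart G Φ A * (H * symPart G Φ A)).trace + (Fintype.card ι - 1) := by
  have h := J.trace_phi_inv_symm J.symPart_symm
  rw [Matrix.mul_assoc] at h
  conv_lhs => rw [J.nabla_xi_eq]
  rw [Matrix.sub_mul, Matrix.mul_sub, Matrix.mul_sub, Matrix.trace_sub, Matrix.trace_sub,
    Matrix.trace_sub, h, Matrix.trace_mul_comm _ Φ, h, J.trace_phi_sq]
  ring

/-- `|h|² = 2n - tr((∇ξ)²)`. -/
theorem norm_hMat : ∑ i, ∑ j, ∑ r, ∑ s, H i r * H j s * (G * hMat Φ X N A) i j *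
    (G * hMat Φ X N A) r s = (Fintype.card ι - 1) - (A * A).trace := by
  rw [sum_norm_sq, J.low_hMat, J.trace_nabla_xi_sq, J.inv_symm]
  have h1 : H * (-(symPart G Φ A * Φ)) * H * (-(symPart G Φ A * Φ))ᵀ =
      -(H * symPart G Φ A * (H * symPart G Φ A)) := by
    rw [Matrix.transpose_neg, Matrix.transpose_mul, J.symPart_symm]
    have h2 : Φ * (H * (Φᵀ * symPart G Φ A)) = -(H * symPart G Φ A) := by
      rw [← Matrix.mul_assoc H, J.inv_mul_transpose, Matrix.neg_mul, Matrix.mul_neg,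
        Matrix.mul_assoc, ← Matrix.mul_assoc Φ Φ, J.phi_sq, Matrix.sub_mul, Matrix.one_mul,
        Matrix.mul_assoc X, ← Matrix.mul_assoc (Xᵀ * G), J.eta_mul_inv, J.xi_symPart,
        Matrix.mul_zero, sub_zero]
    simp only [Matrix.mul_neg, Matrix.neg_mul, neg_neg, Matrix.mul_assoc, h2]
  rw [h1, Matrix.trace_neg]
  ring

end IsContactJet

end Pointwise

/-! ### Contractions of `∇φ` -/

section PointwiseThreeTensor

variable {ι : Type*} [Fintype ι]

theorem sum_rotate (f : ι → ι → ι → ℝ) :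
    ∑ a, ∑ b, ∑ c, f a b c = ∑ a, ∑ b, ∑ c, f b c a := by
  rw [Finset.sum_comm (f := fun a b => ∑ c, f b c a)]
  exact Finset.sum_congr rfl fun b _ => Finset.sum_comm

/-- The square norm of a covariant 3-tensor in terms of the tensor with all indices raised. -/
theorem sum_norm_sq₃ (H : Matrix ι ι ℝ) (p p' : ι → ι → ι → ℝ)
    (h : ∀ r s i, p' r s i = ∑ a, H r a * ∑ b, H s b * ∑ c, p a b c * H c i)
    (hH : Hᵀ = H) :
    ∑ r, ∑ s, ∑ i, ∑ a, ∑ b, ∑ c, H r a * H s b * H i c * p r s i * p a b c =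
      ∑ r, ∑ s, ∑ i, p r s i * p' r s i := by
  refine Finset.sum_congr rfl fun r _ => Finset.sum_congr rfl fun s _ =>
    Finset.sum_congr rfl fun i _ => ?_
  rw [h]
  simp only [Finset.mul_sum]
  refine Finset.sum_congr rfl fun a _ => Finset.sum_congr rfl fun b _ =>
    Finset.sum_congr rfl fun c _ => ?_
  have : H i c = H c i := congrFun (congrFun hH c) i
  rw [this]; ring

variable [DecidableEq ι]

namespace IsContactJet

variable {G H Φ A : Matrix ι ι ℝ} {X : Matrix ι Unit ℝ} {N : ι → Matrix ι ι ℝ}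
  (J : IsContactJet G H Φ X N A)

include J

theorem inv_symm_apply (i j : ι) : H i j = H j i := congrFun (congrFun J.inv_symm j) i

theorem symm_apply (i j : ι) : G i j = G j i := congrFun (congrFun J.symm j) i

theorem low_xi_apply (i : ι) : (G * X) i () = (Xᵀ * G) () i := by
  have : G * X = (Xᵀ * G)ᵀ := by
    rw [Matrix.transpose_mul, J.symm, Matrix.transpose_transpose]
  rw [this, Matrix.transpose_apply]

/-- `φ^{js} ∇_s φ^i_j = 0`: this contracts the cyclic identity with `φ^{js}` and uses that
`φ^{js} φ_{js}` is constant. -/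
theorem sum_nabla_phi_raised (i : ι) : ∑ s, (N s * (Φ * H)) i s = 0 := by
  have hB : ∀ a b, (Φ * H) a b = -(Φ * H) b a := fun a b => by
    have := congrFun (congrFun (J.inv_mul_skew J.phi_skew) b) a
    simpa using this
  have low : ∀ r, ∑ s, (G * (N s * (Φ * H))) r s = 0 := by
    intro r
    have e1 : ∑ s, (G * (N s * (Φ * H))) r s = ∑ s, ∑ j, (G * N s) r j * (Φ * H) j s := by
      simp only [← Matrix.mul_assoc G, Matrix.mul_apply (M := G * N _) (N := Φ * H)]
    have e2 : ∑ s, ∑ j, (G * N r) j s * (Φ * H) j s = 0 := by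
      have : (G * N r * (Φ * H)ᵀ).trace = 0 := by
        rw [J.inv_mul_skew J.phi_skew, Matrix.mul_neg, Matrix.trace_neg, ← Matrix.mul_assoc,
          Matrix.trace_mul_comm, Matrix.mul_assoc, J.inv_mul_cancel, J.nabla_phi_trace, neg_zero]
      rw [Finset.sum_comm]
      simpa only [Matrix.trace, Matrix.diag_apply, Matrix.mul_apply (M := G * N r),
        Matrix.transpose_apply (Φ * H)] using this
    have e3 : ∑ s, ∑ j, (G * N j) s r * (Φ * H) j s = ∑ s, ∑ j, (G * N s) r j * (Φ * H) j s := by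
      rw [Finset.sum_comm]
      refine Finset.sum_congr rfl fun s _ => Finset.sum_congr rfl fun j _ => ?_
      rw [J.low_skew_apply s j r, hB s j]; ring
    have e4 : ∑ s, ∑ j, ((G * N s) r j + (G * N r) j s + (G * N j) s r) * (Φ * H) j s = 0 :=
      Finset.sum_eq_zero fun s _ => Finset.sum_eq_zero fun j _ => by
        rw [J.cyclic s r j, zero_mul]
    simp only [add_mul, Finset.sum_add_distrib, e2, e3] at e4
    rw [e1]; linarith
  have : ∀ s, (N s * (Φ * H)) i s = ∑ r, H i r * (G * (N s * (Φ * H))) r s := fun s => by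
    rw [← Matrix.mul_apply, J.inv_mul_cancel]
  simp only [this]
  rw [Finset.sum_comm]
  simp only [← Finset.mul_sum, low, mul_zero, Finset.sum_const_zero]

theorem sum_nabla_phi_xi : ∑ r, (N r * X) r () = Fintype.card ι - 1 := by
  have h : ∀ r, (N r * X) r () = -(Φ * A) r r := fun r => by rw [J.nabla_phi_xi r]; rfl
  have h2 := J.trace_phi_nabla_xi
  simp only [h, Finset.sum_neg_distrib]
  rw [Matrix.trace] at h2
  simp only [Matrix.diag_apply] at h2
  rw [h2]; ring

/-- The divergence `∇_r φ^r_j = 2n η_j`. -/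
theorem div_phi (j : ι) : ∑ r, N r r j = (Fintype.card ι - 1) * (Xᵀ * G) () j := by
  -- `u` is the divergence of `φ` with its index raised, up to sign.
  set u : Matrix ι Unit ℝ := Matrix.of fun k _ => ∑ s, (N s * H) k s with hu
  have hΦu : Φ * u = 0 := by
    ext i a
    have e1 : (Φ * u) i a = ∑ s, (Φ * N s * H) i s := by
      simp only [Matrix.mul_assoc Φ, Matrix.mul_apply (M := Φ)]
      simp only [hu, Matrix.of_apply, Finset.mul_sum]
      exact Finset.sum_comm
    have e2 : ∀ s, (Φ * N s * H) i s = -(N s * (Φ * H)) i s - A i s * X s () - X i () * A s s := by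
      intro s
      have h : Φ * N s = -(N s * Φ) - column A s * (Xᵀ * G) - X * ((column A s)ᵀ * G) := by
        have := J.nabla_phi_sq s
        rw [← sub_eq_zero] at this ⊢
        rw [← this]; abel
      rw [h, Matrix.sub_mul, Matrix.sub_mul, Matrix.neg_mul, Matrix.mul_assoc (N s),
        Matrix.mul_assoc (column A s), J.eta_mul_inv, Matrix.mul_assoc X, Matrix.mul_assoc _ G H,
        J.mul_inv, Matrix.mul_one]
      simp [Matrix.mul_apply, column]
    have e3 : ∑ s, A i s * X s () = 0 := by
      have := congrFun (congrFun J.nabla_xi_xi i) ()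
      simpa [Matrix.mul_apply] using this
    have e4 : ∑ s, A s s = 0 := J.trace_nabla_xi
    rw [e1]
    simp only [e2, Finset.sum_sub_distrib, Finset.sum_neg_distrib, J.sum_nabla_phi_raised, e3,
      ← Finset.mul_sum, e4]
    simp
  have hD : ∀ j, ∑ r, N r r j = -(uᵀ * G) () j := by
    intro j
    have : ∀ r, N r r j = -∑ k, (N r * H) k r * G k j := fun r => by
      have h1 : N r = -((N r * H)ᵀ * G) := by
        rw [J.inv_mul_skew (J.nabla_skew r), Matrix.neg_mul, neg_neg, Matrix.mul_assoc,
          J.inv_mul, Matrix.mul_one]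
      conv_lhs => rw [h1]
      rw [Matrix.neg_apply, Matrix.mul_apply (M := (N r * H)ᵀ)]
      rfl
    simp only [this, Finset.sum_neg_distrib]
    rw [Finset.sum_comm, Matrix.mul_apply]
    simp [hu, Finset.sum_mul]
  have hu2 : u = X * (Xᵀ * G * u) := by
    have h : Φ * (Φ * u) = 0 := by rw [hΦu, Matrix.mul_zero]
    rw [← Matrix.mul_assoc, J.phi_sq, Matrix.sub_mul, Matrix.one_mul, sub_eq_zero] at h
    rw [← Matrix.mul_assoc X]; exact h
  have hc : (Xᵀ * G * u) () () = -(Fintype.card ι - 1) := by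
    have h1 : (Xᵀ * G * u) () () = (uᵀ * G * X) () () := by
      have : (Xᵀ * G * u)ᵀ = uᵀ * G * X := by
        rw [Matrix.transpose_mul, Matrix.transpose_mul, J.symm, Matrix.transpose_transpose,
          Matrix.mul_assoc]
      rw [← this]; rfl
    have h2 : (uᵀ * G * X) () () = -∑ r, (N r * X) r () := by
      simp only [Matrix.mul_apply (N := X)]
      rw [Finset.sum_comm]
      simp only [← Finset.sum_mul, hD]
      simp
    rw [h1, h2, J.sum_nabla_phi_xi]
  have hu3 : u = (-(Fintype.card ι - 1 : ℝ)) • X := by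
    rw [hu2]
    ext i a
    rw [Matrix.mul_apply]
    simp [hc, mul_comm]
  rw [hD, hu3]
  simp only [Matrix.transpose_smul, Matrix.smul_mul, Matrix.smul_apply, smul_eq_mul]
  ring

/-- The tensor `∇_r φ_{si}` with all its indices raised. -/
theorem raised_nabla_phi (r s i : ι) : (∑ a, H r a • (N a * H)) s i =
    ∑ a, H r a * ∑ b, H s b * ∑ c, (G * N a) b c * H c i := by
  rw [Matrix.sum_apply]
  refine Finset.sum_congr rfl fun a _ => ?_
  rw [Matrix.smul_apply, smul_eq_mul]
  congr 1
  rw [← J.inv_mul_cancel (N a * H), ← Matrix.mul_assoc G, Matrix.mul_apply (M := H)]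
  simp only [Matrix.mul_apply (M := G * N a)]

theorem raised_skew (r s i : ι) :
    (∑ a, H r a • (N a * H)) s i = -(∑ a, H r a • (N a * H)) i s := by
  simp only [Matrix.sum_apply, Matrix.smul_apply, smul_eq_mul]
  rw [← Finset.sum_neg_distrib]
  refine Finset.sum_congr rfl fun a _ => ?_
  have := congrFun (congrFun (J.inv_mul_skew (J.nabla_skew a)) i) s
  rw [Matrix.transpose_apply, Matrix.neg_apply] at this
  rw [this]; ring

theorem raised_cyclic (r s i : ι) : (∑ a, H r a • (N a * H)) s i +
    (∑ a, H s a • (N a * H)) i r + (∑ a, H i a • (N a * H)) r s = 0 := by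
  have e : ∀ r s i, (∑ a, H r a • (N a * H)) s i =
      ∑ a, ∑ b, ∑ c, H r a * H s b * H i c * (G * N a) b c := fun r s i => by
    rw [J.raised_nabla_phi]
    simp only [Finset.mul_sum]
    refine Finset.sum_congr rfl fun a _ => Finset.sum_congr rfl fun b _ =>
      Finset.sum_congr rfl fun c _ => ?_
    rw [J.inv_symm_apply c i]; ring
  have e1 : (∑ a, H s a • (N a * H)) i r =
      ∑ a, ∑ b, ∑ c, H r a * H s b * H i c * (G * N b) c a := by
    rw [e, sum_rotate]
    refine Finset.sum_congr rfl fun a _ => Finset.sum_congr rfl fun b _ =>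
      Finset.sum_congr rfl fun c _ => by ring
  have e2 : (∑ a, H i a • (N a * H)) r s =
      ∑ a, ∑ b, ∑ c, H r a * H s b * H i c * (G * N c) a b := by
    rw [e, sum_rotate, sum_rotate]
    refine Finset.sum_congr rfl fun a _ => Finset.sum_congr rfl fun b _ =>
      Finset.sum_congr rfl fun c _ => by ring
  rw [e, e1, e2]
  simp only [← Finset.sum_add_distrib, ← mul_add]
  exact Finset.sum_eq_zero fun a _ => Finset.sum_eq_zero fun b _ => Finset.sum_eq_zero fun c _ => by
    rw [J.cyclic, mul_zero]

/-- `|∇φ|²` as a single contraction. -/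
theorem norm_nabla_phi :
    ∑ r, ∑ s, ∑ i, ∑ a, ∑ b, ∑ c, H r a * H s b * H i c * (G * N r) s i * (G * N a) b c =
      ∑ r, ∑ s, ∑ i, (G * N r) s i * (∑ a, H r a • (N a * H)) s i :=
  sum_norm_sq₃ H (fun r s i => (G * N r) s i) _ (fun r s i => J.raised_nabla_phi r s i)
    J.inv_symm

/-- The contraction `∇_r φ^{js} ∇_s φ^r_j = -½ |∇φ|²`, a consequence of the cyclic identity. -/
theorem sum_nabla_phi_nabla_phi : ∑ r, ∑ s, ∑ j, (N r * H) j s * N s r j =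
    -(1 / 2) * ∑ r, ∑ s, ∑ i, (G * N r) s i * (∑ a, H r a • (N a * H)) s i := by
  set M : ι → ι → ι → ℝ := fun r s i => (∑ a, H r a • (N a * H)) s i with hM
  change _ = -(1 / 2) * ∑ r, ∑ s, ∑ i, (G * N r) s i * M r s i
  have e1 : ∑ r, ∑ s, ∑ j, (N r * H) j s * N s r j =
      ∑ s, ∑ a, ∑ j, M a j s * (G * N s) a j := by
    rw [Finset.sum_comm]
    refine Finset.sum_congr rfl fun s _ => ?_
    have : ∀ r j, N s r j = ∑ a, H r a * (G * N s) a j := fun r j => by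
      rw [← Matrix.mul_apply, J.inv_mul_cancel]
    simp only [this, Finset.mul_sum, hM, Matrix.sum_apply, Finset.sum_mul, Matrix.smul_apply,
      smul_eq_mul]
    refine (Finset.sum_congr rfl fun r _ => Finset.sum_comm).trans (Finset.sum_comm.trans
      (Finset.sum_congr rfl fun a _ => Finset.sum_comm.trans (Finset.sum_congr rfl fun j _ =>
        Finset.sum_congr rfl fun r _ => ?_)))
    rw [J.inv_symm_apply r a]; ring
  have e2 : ∑ s, ∑ a, ∑ j, M a j s * (G * N s) a j =
      ∑ s, ∑ a, ∑ j, M j s a * (G * N s) a j := by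
    refine Finset.sum_congr rfl fun s _ => ?_
    rw [Finset.sum_comm]
    refine Finset.sum_congr rfl fun a _ => Finset.sum_congr rfl fun j _ => ?_
    have h1 : M j a s = -M j s a := J.raised_skew j a s
    rw [h1, J.low_skew_apply s j a]; ring
  have e3 : ∑ s, ∑ a, ∑ j, (M a j s + M j s a + M s a j) * (G * N s) a j = 0 :=
    Finset.sum_eq_zero fun s _ => Finset.sum_eq_zero fun a _ => Finset.sum_eq_zero fun j _ => by
      rw [show M a j s + M j s a + M s a j = 0 from J.raised_cyclic a j s, zero_mul]
  simp only [add_mul, Finset.sum_add_distrib, ← e2] at e3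
  simp only [mul_comm ((G * N _) _ _)]
  rw [e1]; linarith

/-- `|P|² = |∇φ|² - 4n` for `P_{rsi} = ∇_r φ_{si} - η_i g_{rs} + η_s g_{ri}`. -/
theorem norm_tensorP (P : ι → ι → ι → ℝ) (hP : ∀ r s i, P r s i =
      (G * N r) s i - (Xᵀ * G) () i * G r s + (Xᵀ * G) () s * G r i) :
    ∑ r, ∑ s, ∑ i, ∑ a, ∑ b, ∑ c, H r a * H s b * H i c * P r s i * P a b c =
      ∑ r, ∑ s, ∑ i, (G * N r) s i * (∑ a, H r a • (N a * H)) s i -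
        2 * (Fintype.card ι - 1) := by
  set M : ι → ι → ι → ℝ := fun r s i => (∑ a, H r a • (N a * H)) s i with hM
  set Y : ι → ℝ := fun i => (Xᵀ * G) () i with hY
  have hHG : ∀ i j, ∑ a, H i a * G a j = if i = j then 1 else 0 := fun i j => by
    rw [← Matrix.mul_apply, J.inv_mul, Matrix.one_apply]
  have hYH : ∀ i, ∑ c, Y c * H c i = X i () := fun i => by
    rw [← Matrix.transpose_apply X, ← J.eta_mul_inv, Matrix.mul_apply]
  have hXY : ∑ i, X i () * Y i = 1 := by
    have := congrFun (congrFun J.eta_xi ()) ()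
    rw [Matrix.mul_apply] at this
    simpa [hY, mul_comm] using this
  have hraise : ∀ r s i, M r s i - X i () * H r s + X s () * H r i =
      ∑ a, H r a * ∑ b, H s b * ∑ c, P a b c * H c i := by
    intro r s i
    have h1 : ∀ a b, ∑ c, P a b c * H c i = ∑ c, (G * N a) b c * H c i - G a b * X i () +
        Y b * ∑ c, G a c * H c i := fun a b => by
      rw [← hYH, Finset.mul_sum, Finset.mul_sum, ← Finset.sum_sub_distrib,
        ← Finset.sum_add_distrib]
      refine Finset.sum_congr rfl fun c _ => ?_
      rw [hP]; ring
    have h2 : ∀ a, ∑ b, H s b * ∑ c, P a b c * H c i =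
        ∑ b, H s b * ∑ c, (G * N a) b c * H c i - (if s = a then 1 else 0) * X i () +
          X s () * ∑ c, G a c * H c i := fun a => by
      rw [← hHG s a, ← hYH s, Finset.sum_mul, Finset.sum_mul, ← Finset.sum_sub_distrib,
        ← Finset.sum_add_distrib]
      refine Finset.sum_congr rfl fun b _ => ?_
      rw [h1, J.symm_apply a b, J.inv_symm_apply s b]; ring
    have h3 : ∀ a, ∑ c, G a c * H c i = if a = i then 1 else 0 := fun a => by
      rw [← Matrix.mul_apply, J.mul_inv, Matrix.one_apply]
    simp only [h2, h3, mul_add, mul_sub, Finset.sum_add_distrib, Finset.sum_sub_distrib, hM,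
      J.raised_nabla_phi r s i]
    simp
    ring
  rw [sum_norm_sq₃ H P _ hraise J.inv_symm]
  have c1 : ∑ r, ∑ s, ∑ i, (G * N r) s i * (X i () * H r s) = Fintype.card ι - 1 := by
    rw [← J.sum_nabla_phi_xi]
    refine Finset.sum_congr rfl fun r _ => ?_
    rw [← J.inv_mul_cancel (N r * X), Matrix.mul_apply (M := H)]
    refine Finset.sum_congr rfl fun s _ => ?_
    rw [← Matrix.mul_assoc, Matrix.mul_apply (M := G * N r), Finset.mul_sum]
    exact Finset.sum_congr rfl fun i _ => by ring
  have c2 : ∑ r, ∑ s, ∑ i, (G * N r) s i * (X s () * H r i) = -(Fintype.card ι - 1) := by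
    rw [← c1, ← Finset.sum_neg_distrib]
    refine Finset.sum_congr rfl fun r _ => ?_
    rw [Finset.sum_comm, ← Finset.sum_neg_distrib]
    refine Finset.sum_congr rfl fun s _ => ?_
    rw [← Finset.sum_neg_distrib]
    refine Finset.sum_congr rfl fun i _ => ?_
    rw [J.low_skew_apply r i s]; ring
  have c3 : ∑ r, ∑ s, ∑ i, Y i * G r s * M r s i = Fintype.card ι - 1 := by
    have hGM : ∀ s i, ∑ r, G s r * M r s i = (N s * H) s i := fun s i => by
      have : ∑ r, G s r • ∑ a, H r a • (N a * H) = N s * H := by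
        simp only [Finset.smul_sum, smul_smul]
        rw [Finset.sum_comm]
        simp only [← Finset.sum_smul, ← Matrix.mul_apply, J.mul_inv, Matrix.one_apply]
        simp
      rw [← this]
      simp [hM, Matrix.sum_apply]
    rw [← J.sum_nabla_phi_xi, Finset.sum_comm]
    refine Finset.sum_congr rfl fun s _ => ?_
    rw [Finset.sum_comm]
    have : N s * X = N s * H * (G * X) := by rw [Matrix.mul_assoc, J.inv_mul_cancel]
    rw [this, Matrix.mul_apply (M := N s * H)]
    refine Finset.sum_congr rfl fun i _ => ?_
    rw [← hGM, Finset.sum_mul]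
    refine Finset.sum_congr rfl fun r _ => ?_
    rw [J.low_xi_apply, J.symm_apply r s]; ring
  have c4 : ∑ r, ∑ s, ∑ i, Y s * G r i * M r s i = -(Fintype.card ι - 1) := by
    rw [← c3, ← Finset.sum_neg_distrib]
    refine Finset.sum_congr rfl fun r _ => ?_
    rw [Finset.sum_comm, ← Finset.sum_neg_distrib]
    refine Finset.sum_congr rfl fun s _ => ?_
    rw [← Finset.sum_neg_distrib]
    refine Finset.sum_congr rfl fun i _ => ?_
    rw [show M r i s = -M r s i from J.raised_skew r i s]; ring
  have c5 : ∑ r, ∑ s, ∑ i, (Y i * G r s - Y s * G r i) * (X i () * H r s - X s () * H r i) =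
      2 * (Fintype.card ι - 1) := by
    have d1 : ∑ r, ∑ s, ∑ i, (X i () * Y i) * (H r s * G s r) = (Fintype.card ι : ℝ) := by
      simp only [← Finset.sum_mul, hXY, one_mul, hHG]
      simp
    have d2 : ∑ r, ∑ s, ∑ i, (X s () * Y s) * (H r i * G i r) = (Fintype.card ι : ℝ) := by
      simp only [← Finset.mul_sum, hHG]
      simp [hXY]
    have d3 : ∑ r, ∑ s, ∑ i, (X s () * Y i) * (H i r * G r s) = 1 := by
      have : ∀ s i, ∑ r, (X s () * Y i) * (H i r * G r s) =
          if i = s then X s () * Y s else 0 := fun s i => by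
        rw [← Finset.mul_sum, hHG]; split_ifs with h <;> simp [h]
      rw [← sum_rotate]
      simp [this, hXY]
    have d4 : ∑ r, ∑ s, ∑ i, (X i () * Y s) * (H s r * G r i) = 1 := by
      rw [← d3]
      exact Finset.sum_congr rfl fun r _ => Finset.sum_comm
    have d5 : ∀ r s i, (Y i * G r s - Y s * G r i) * (X i () * H r s - X s () * H r i) =
        (X i () * Y i) * (H r s * G s r) + (X s () * Y s) * (H r i * G i r) -
          (X s () * Y i) * (H i r * G r s) - (X i () * Y s) * (H s r * G r i) := by
      intro r s i
      rw [J.symm_apply s r, J.symm_apply i r, J.inv_symm_apply i r, J.inv_symm_apply s r]; ring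
    simp only [d5, Finset.sum_sub_distrib, Finset.sum_add_distrib, d1, d2, d3, d4]
    ring
  have split : ∀ r s i, P r s i * (M r s i - X i () * H r s + X s () * H r i) =
      (G * N r) s i * M r s i - (G * N r) s i * (X i () * H r s) +
      (G * N r) s i * (X s () * H r i) - Y i * G r s * M r s i + Y s * G r i * M r s i +
      (Y i * G r s - Y s * G r i) * (X i () * H r s - X s () * H r i) := by
    intro r s i
    rw [hP]; ring
  simp only [split, Finset.sum_add_distrib, Finset.sum_sub_distrib, c1, c2, c3, c4, c5]
  ring

/-- The Nijenhuis tensor `N_φ(∂_r, ∂_s)` in terms of `∇φ`. For a normal structure it equals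
`2 dη(∂_r, ∂_s) ξ`, and contracting with `ξ^s` gives `h = 0`. -/
theorem hMat_eq_zero (hN : ∀ r s i, ∑ k, (Φ k r * N k i s - Φ k s * N k i r) +
      (Φ * N s) i r - (Φ * N r) i s = 2 * (G * Φ) r s * X i ()) :
    hMat Φ X N A = 0 := by
  have h1 : Φ * hMat Φ X N A = 0 := by
    ext i r
    have hc : ∑ s, (∑ k, (Φ k r * N k i s - Φ k s * N k i r) + (Φ * N s) i r - (Φ * N r) i s) *
        X s () = 0 := by
      simp only [hN]
      have : ∑ s, (G * Φ) r s * X s () = 0 := by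
        rw [← Matrix.mul_apply, Matrix.mul_assoc, J.phi_xi]; simp
      calc _ = ∑ s, 2 * X i () * ((G * Φ) r s * X s ()) :=
            Finset.sum_congr rfl fun s _ => by ring
        _ = 0 := by rw [← Finset.mul_sum, this, mul_zero]
    have t1 : ∑ s, (∑ k, Φ k r * N k i s) * X s () = -(Φ * A * Φ) i r := by
      have : ∀ k, ∑ s, N k i s * X s () = -(Φ * A) i k := fun k => by
        rw [← Matrix.mul_apply, J.nabla_phi_xi k]; rfl
      simp only [Finset.sum_mul]
      rw [Finset.sum_comm, Matrix.mul_apply (M := Φ * A), ← Finset.sum_neg_distrib]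
      refine Finset.sum_congr rfl fun k _ => ?_
      rw [← neg_mul, ← this k, Finset.sum_mul]
      exact Finset.sum_congr rfl fun s _ => by ring
    have t2 : ∑ s, (∑ k, Φ k s * N k i r) * X s () = 0 := by
      have : ∀ k, ∑ s, Φ k s * X s () = 0 := fun k => by
        rw [← Matrix.mul_apply, J.phi_xi]; rfl
      simp only [Finset.sum_mul]
      rw [Finset.sum_comm]
      refine Finset.sum_eq_zero fun k _ => ?_
      calc _ = ∑ s, N k i r * (Φ k s * X s ()) := Finset.sum_congr rfl fun s _ => by ring
        _ = 0 := by rw [← Finset.mul_sum, this, mul_zero]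
    have t3 : ∑ s, (Φ * N s) i r * X s () = (Φ * nablaXi X N) i r := by
      rw [nablaXi, Matrix.mul_sum, Matrix.sum_apply]
      simp [mul_comm]
    have t4 : ∑ s, (Φ * N r) i s * X s () = -(Φ * (Φ * A)) i r := by
      rw [← Matrix.mul_apply, Matrix.mul_assoc, J.nabla_phi_xi r, Matrix.mul_neg]; rfl
    simp only [add_mul, sub_mul, Finset.sum_add_distrib, Finset.sum_sub_distrib, t1, t2, t3,
      t4] at hc
    rw [hMat, Matrix.mul_smul, Matrix.mul_add, Matrix.mul_sub, ← Matrix.mul_assoc Φ A]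
    simp only [Matrix.smul_apply, Matrix.add_apply, Matrix.sub_apply, smul_eq_mul,
      Matrix.zero_apply]
    linarith
  have h2 : Xᵀ * G * hMat Φ X N A = 0 := by
    rw [Matrix.mul_assoc, J.low_hMat, Matrix.mul_neg, ← Matrix.mul_assoc, J.xi_symPart]; simp
  have h3 : Φ * (Φ * hMat Φ X N A) = 0 := by rw [h1, Matrix.mul_zero]
  rwa [← Matrix.mul_assoc, J.phi_sq, Matrix.sub_mul, Matrix.one_mul, Matrix.mul_assoc X, h2,
    Matrix.mul_zero, sub_zero] at h3

/-- For a normal structure `∇_p φ_{is} = η_s g_{pi} - η_i g_{ps}`, that is, `P = 0`. -/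
theorem low_nabla_phi_of_normal (hN : ∀ r s i, ∑ k, (Φ k r * N k i s - Φ k s * N k i r) +
      (Φ * N s) i r - (Φ * N r) i s = 2 * (G * Φ) r s * X i ()) (p i s : ι) :
    (G * N p) i s = (Xᵀ * G) () s * G p i - (Xᵀ * G) () i * G p s := by
  set Y : ι → ℝ := fun i => (Xᵀ * G) () i with hY
  have hS : symPart G Φ A = 0 := by
    rw [← J.symPart_phi_phi]
    have := J.low_hMat
    rw [J.hMat_eq_zero hN, Matrix.mul_zero, eq_comm, neg_eq_zero] at this
    rw [this, Matrix.zero_mul]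
  have hA : A = -Φ := by rw [J.nabla_xi_eq, hS]; simp
  have hΦΦ : (G * (Φ * Φ))ᵀ = G * (Φ * Φ) := by
    rw [Matrix.transpose_mul, Matrix.transpose_mul, J.symm, Matrix.mul_assoc, J.phi_skew,
      Matrix.mul_neg, ← Matrix.mul_assoc, J.phi_skew, Matrix.neg_mul, neg_neg, Matrix.mul_assoc]
  have hξ : G * nablaXi X N = 0 := by
    rw [J.low_nablaXi, hA, Matrix.mul_neg, Matrix.mul_neg, Matrix.transpose_neg, hΦΦ, sub_self]
  -- `m r i s = φ^k_r ∇_k φ_{is}`; the lowered normality condition is a relation between its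
  -- cyclic permutations, which determines it.
  set m : ι → ι → ι → ℝ := fun r i s => ∑ k, Φ k r * (G * N k) i s with hm
  have m_skew : ∀ r i s, m r i s = -m r s i := fun r i s => by
    simp only [hm, ← Finset.sum_neg_distrib]
    exact Finset.sum_congr rfl fun k _ => by rw [J.low_skew_apply k i s]; ring
  have rel : ∀ r i s, m r i s - m s i r + m i r s = 2 * (G * Φ) r s * Y i := by
    intro r i s
    have hc : ∑ j, G i j * (∑ k, (Φ k r * N k j s - Φ k s * N k j r) +
        (Φ * N s) j r - (Φ * N r) j s) = 2 * (G * Φ) r s * Y i := by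
      simp only [hN]
      have : Y i = ∑ j, G i j * X j () := by
        rw [← Matrix.mul_apply, J.low_xi_apply]
      rw [this, Finset.mul_sum]
      exact Finset.sum_congr rfl fun j _ => by ring
    have t1 : ∀ r s, ∑ j, G i j * ∑ k, Φ k r * N k j s = m r i s := fun r s => by
      simp only [hm, Matrix.mul_apply (M := G), Finset.mul_sum]
      rw [Finset.sum_comm]
      exact Finset.sum_congr rfl fun k _ => Finset.sum_congr rfl fun j _ => by ring
    have t2 : ∀ r s, ∑ j, G i j * (Φ * N s) j r = -∑ k, Φ k i * (G * N s) k r := fun r s => by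
      rw [← Matrix.mul_apply, ← Matrix.mul_assoc]
      have : G * Φ = -(Φᵀ * G) := by rw [J.phi_skew, neg_neg]
      rw [this, Matrix.neg_mul, Matrix.neg_apply, Matrix.mul_assoc,
        Matrix.mul_apply (M := Φᵀ)]
      rfl
    have t3 : ∑ k, Φ k i * (G * N s) k r - ∑ k, Φ k i * (G * N r) k s = -m i r s := by
      simp only [hm, ← Finset.sum_sub_distrib, ← Finset.sum_neg_distrib]
      refine Finset.sum_congr rfl fun k _ => ?_
      have h1 := J.cyclic s k r
      have h2 := J.low_skew_apply r k s
      have : (G * N s) k r - (G * N r) k s = -(G * N k) r s := by linarith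
      rw [← mul_sub, this]; ring
    simp only [mul_add, mul_sub, Finset.sum_add_distrib, Finset.sum_sub_distrib, t1, t2] at hc
    linarith
  have sol : ∀ r i s, m r i s = (G * Φ) r s * Y i + (G * Φ) i r * Y s := by
    intro r i s
    have h1 := rel r i s
    have h2 := rel i s r
    have h3 := m_skew i s r
    have h4 := m_skew r s i
    linarith
  have e1 : ∑ r, Φ r p * m r i s = (G * N p) i s := by
    have h0 : ∀ k, ∑ r, Φ k r * Φ r p = (if k = p then 1 else 0) - X k () * Y p := fun k => by
      rw [← Matrix.mul_apply, J.phi_sq, Matrix.sub_apply, Matrix.one_apply,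
        Matrix.mul_apply (M := X)]
      simp [hY]
    have hx : ∑ k, X k () * (G * N k) i s = 0 := by
      have := congrFun (congrFun hξ i) s
      rw [nablaXi, Matrix.mul_sum, Matrix.sum_apply] at this
      simpa using this
    calc ∑ r, Φ r p * m r i s = ∑ k, (∑ r, Φ k r * Φ r p) * (G * N k) i s := by
          simp only [hm, Finset.mul_sum, Finset.sum_mul]
          rw [Finset.sum_comm]
          exact Finset.sum_congr rfl fun k _ => Finset.sum_congr rfl fun j _ => by ring
      _ = (G * N p) i s - Y p * ∑ k, X k () * (G * N k) i s := by
          simp only [h0, sub_mul, Finset.sum_sub_distrib, Finset.mul_sum]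
          simp [mul_comm, mul_assoc, mul_left_comm]
      _ = _ := by rw [hx]; ring
  have e2 : ∀ i, ∑ r, Φ r p * (G * Φ) i r = G p i - Y p * Y i := fun i => by
    calc _ = (G * Φ * Φ) i p := by
          rw [Matrix.mul_apply (M := G * Φ)]
          exact Finset.sum_congr rfl fun r _ => by ring
      _ = _ := by
          rw [Matrix.mul_assoc, J.phi_sq, Matrix.mul_sub, Matrix.mul_one, ← Matrix.mul_assoc]
          have : G * X = (Xᵀ * G)ᵀ := by
            rw [Matrix.transpose_mul, J.symm, Matrix.transpose_transpose]
          rw [this, Matrix.sub_apply, Matrix.mul_apply (N := Xᵀ * G), J.symm_apply i p]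
          simp [hY, mul_comm]
  have e3 : ∑ r, Φ r p * (G * Φ) r s = -(G p s - Y p * Y s) := by
    rw [← e2, ← Finset.sum_neg_distrib]
    refine Finset.sum_congr rfl fun r _ => ?_
    have := congrFun (congrFun (J.low_skew J.phi_skew) s) r
    rw [Matrix.transpose_apply, Matrix.neg_apply] at this
    rw [this]; ring
  rw [← e1]
  calc ∑ r, Φ r p * m r i s = (∑ r, Φ r p * (G * Φ) r s) * Y i +
        (∑ r, Φ r p * (G * Φ) i r) * Y s := by
        rw [Finset.sum_mul, Finset.sum_mul, ← Finset.sum_add_distrib]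
        exact Finset.sum_congr rfl fun r _ => by rw [sol]; ring
    _ = _ := by rw [e2, e3]; ring

end IsContactJet

end PointwiseThreeTensor

/-! ### Matrix-valued functions and the Levi-Civita connection -/

section MatrixCalculus

variable {m : ℕ} {κ ι ν : Type*}

/-- The partial derivative `∂_r F` of a matrix-valued function, entry by entry. -/
noncomputable def mpartial (r : Fin m) (F : EuclideanSpace ℝ (Fin m) → Matrix κ ι ℝ)
    (y : EuclideanSpace ℝ (Fin m)) : Matrix κ ι ℝ :=
  Matrix.of fun i j => partialD r (fun z => F z i j) y

/-- A matrix-valued function has smooth entries on `U`. -/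
def SmoothEntries (U : Set (EuclideanSpace ℝ (Fin m)))
    (F : EuclideanSpace ℝ (Fin m) → Matrix κ ι ℝ) : Prop :=
  ∀ i j, ContDiffOn ℝ ∞ (fun z => F z i j) U

variable {U : Set (EuclideanSpace ℝ (Fin m))} {y : EuclideanSpace ℝ (Fin m)}

theorem contDiffOn_partialD (hU : IsOpen U) {f : EuclideanSpace ℝ (Fin m) → ℝ}
    (hf : ContDiffOn ℝ ∞ f U) (r : Fin m) : ContDiffOn ℝ ∞ (partialD r f) U :=
  (hf.fderiv_of_isOpen (m := ∞) hU (by simp)).clm_apply contDiffOn_const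

theorem differentiableAt_of_contDiffOn (hU : IsOpen U) {F : Type*} [NormedAddCommGroup F]
    [NormedSpace ℝ F] {f : EuclideanSpace ℝ (Fin m) → F}
    (hf : ContDiffOn ℝ ∞ f U) (hy : y ∈ U) : DifferentiableAt ℝ f y :=
  (hf.contDiffAt (hU.mem_nhds hy)).differentiableAt (by simp)

theorem partialD_congr (hU : IsOpen U) {f g : EuclideanSpace ℝ (Fin m) → ℝ}
    (h : ∀ z ∈ U, f z = g z) (hy : y ∈ U) (r : Fin m) : partialD r f y = partialD r g y := by
  have : f =ᶠ[nhds y] g := Filter.eventuallyEq_of_mem (hU.mem_nhds hy) h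
  rw [partialD, partialD, this.fderiv_eq]

theorem partialD_comm (hU : IsOpen U) {f : EuclideanSpace ℝ (Fin m) → ℝ}
    (hf : ContDiffOn ℝ ∞ f U) (hy : y ∈ U) (r s : Fin m) :
    partialD r (partialD s f) y = partialD s (partialD r f) y := by
  have h2 : DifferentiableAt ℝ (fderiv ℝ f) y :=
    differentiableAt_of_contDiffOn hU (hf.fderiv_of_isOpen (m := ∞) hU (by simp)) hy
  have h3 : ∀ r s, partialD r (partialD s f) y =
      fderiv ℝ (fderiv ℝ f) y (coordVec r) (coordVec s) := fun r s => by
    change fderiv ℝ (fun z => fderiv ℝ f z (coordVec s)) y (coordVec r) = _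
    rw [fderiv_clm_apply h2 (differentiableAt_const _)]
    simp
  rw [h3, h3]
  exact (hf.contDiffAt (hU.mem_nhds hy)).isSymmSndFDerivAt
    (by simpa using (mod_cast le_top : ((2 : ℕ∞) : WithTop ℕ∞) ≤ ∞)) _ _

theorem partialD_add {f g : EuclideanSpace ℝ (Fin m) → ℝ} (hf : DifferentiableAt ℝ f y)
    (hg : DifferentiableAt ℝ g y) (r : Fin m) :
    partialD r (fun z => f z + g z) y = partialD r f y + partialD r g y := by
  simp [partialD, fderiv_fun_add hf hg]

theorem partialD_sub {f g : EuclideanSpace ℝ (Fin m) → ℝ} (hf : DifferentiableAt ℝ f y)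
    (hg : DifferentiableAt ℝ g y) (r : Fin m) :
    partialD r (fun z => f z - g z) y = partialD r f y - partialD r g y := by
  simp [partialD, fderiv_fun_sub hf hg]

theorem partialD_mul {f g : EuclideanSpace ℝ (Fin m) → ℝ} (hf : DifferentiableAt ℝ f y)
    (hg : DifferentiableAt ℝ g y) (r : Fin m) :
    partialD r (fun z => f z * g z) y = partialD r f y * g y + f y * partialD r g y := by
  simp [partialD, fderiv_fun_mul hf hg]; ring

theorem partialD_sum {α : Type*} {s : Finset α} {f : α → EuclideanSpace ℝ (Fin m) → ℝ}
    (hf : ∀ a ∈ s, DifferentiableAt ℝ (f a) y) (r : Fin m) :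
    partialD r (fun z => ∑ a ∈ s, f a z) y = ∑ a ∈ s, partialD r (f a) y := by
  simp [partialD, fderiv_fun_sum hf]

theorem partialD_const (c : ℝ) (r : Fin m) : partialD r (fun _ => c) y = 0 := by
  simp [partialD]

section

variable {F : EuclideanSpace ℝ (Fin m) → Matrix κ ι ℝ}

theorem SmoothEntries.differentiableAt (hF : SmoothEntries U F) (hU : IsOpen U) (hy : y ∈ U)
    (i : κ) (j : ι) : DifferentiableAt ℝ (fun z => F z i j) y :=
  differentiableAt_of_contDiffOn hU (hF i j) hy

theorem SmoothEntries.mpartial (hF : SmoothEntries U F) (hU : IsOpen U) (r : Fin m) :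
    SmoothEntries U (mpartial r F) :=
  fun i j => contDiffOn_partialD hU (hF i j) r

theorem SmoothEntries.transpose (hF : SmoothEntries U F) : SmoothEntries U (fun z => (F z)ᵀ) :=
  fun i j => hF j i

theorem SmoothEntries.add {F' : EuclideanSpace ℝ (Fin m) → Matrix κ ι ℝ}
    (hF : SmoothEntries U F) (hF' : SmoothEntries U F') : SmoothEntries U (fun z => F z + F' z) :=
  fun i j => (hF i j).add (hF' i j)

theorem SmoothEntries.sub {F' : EuclideanSpace ℝ (Fin m) → Matrix κ ι ℝ}
    (hF : SmoothEntries U F) (hF' : SmoothEntries U F') : SmoothEntries U (fun z => F z - F' z) :=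
  fun i j => (hF i j).sub (hF' i j)

theorem SmoothEntries.mul [Fintype ι] {F' : EuclideanSpace ℝ (Fin m) → Matrix ι ν ℝ}
    (hF : SmoothEntries U F) (hF' : SmoothEntries U F') :
    SmoothEntries U (fun z => F z * F' z) := fun i j => by
  simp only [Matrix.mul_apply]
  exact ContDiffOn.sum fun k _ => (hF i k).mul (hF' k j)

theorem SmoothEntries.det [Fintype ι] [DecidableEq ι]
    {F : EuclideanSpace ℝ (Fin m) → Matrix ι ι ℝ} (hF : SmoothEntries U F) :
    ContDiffOn ℝ ∞ (fun z => (F z).det) U := by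
  simp only [Matrix.det_apply']
  exact ContDiffOn.sum fun σ _ => contDiffOn_const.mul (contDiffOn_prod fun k _ => hF _ _)

theorem SmoothEntries.inv [Fintype ι] [DecidableEq ι]
    {F : EuclideanSpace ℝ (Fin m) → Matrix ι ι ℝ} (hF : SmoothEntries U F)
    (h : ∀ z ∈ U, IsUnit (F z).det) : SmoothEntries U (fun z => (F z)⁻¹) := fun i j => by
  simp only [Matrix.inv_def, Ring.inverse_eq_inv', Matrix.smul_apply, smul_eq_mul,
    Matrix.adjugate_apply]
  refine (hF.det.inv fun z hz => (h z hz).ne_zero).mul (SmoothEntries.det fun a b => ?_)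
  simp only [Matrix.updateRow_apply]
  split_ifs
  · exact contDiffOn_const
  · exact hF a b

theorem mpartial_congr (hU : IsOpen U) {F' : EuclideanSpace ℝ (Fin m) → Matrix κ ι ℝ}
    (h : ∀ z ∈ U, F z = F' z) (hy : y ∈ U) (r : Fin m) : mpartial r F y = mpartial r F' y := by
  ext i j
  exact partialD_congr hU (fun z hz => by rw [h z hz]) hy r

theorem mpartial_transpose (r : Fin m) : mpartial r (fun z => (F z)ᵀ) y = (mpartial r F y)ᵀ := rfl

theorem mpartial_const (C : Matrix κ ι ℝ) (r : Fin m) : mpartial r (fun _ => C) y = 0 := by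
  ext i j
  exact partialD_const _ r

theorem mpartial_add {F' : EuclideanSpace ℝ (Fin m) → Matrix κ ι ℝ} (hU : IsOpen U) (hy : y ∈ U)
    (hF : SmoothEntries U F) (hF' : SmoothEntries U F') (r : Fin m) :
    mpartial r (fun z => F z + F' z) y = mpartial r F y + mpartial r F' y := by
  ext i j
  exact partialD_add (hF.differentiableAt hU hy i j) (hF'.differentiableAt hU hy i j) r

theorem mpartial_sub {F' : EuclideanSpace ℝ (Fin m) → Matrix κ ι ℝ} (hU : IsOpen U) (hy : y ∈ U)
    (hF : SmoothEntries U F) (hF' : SmoothEntries U F') (r : Fin m) :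
    mpartial r (fun z => F z - F' z) y = mpartial r F y - mpartial r F' y := by
  ext i j
  exact partialD_sub (hF.differentiableAt hU hy i j) (hF'.differentiableAt hU hy i j) r

theorem mpartial_mul [Fintype ι] {F' : EuclideanSpace ℝ (Fin m) → Matrix ι ν ℝ} (hU : IsOpen U)
    (hy : y ∈ U) (hF : SmoothEntries U F) (hF' : SmoothEntries U F') (r : Fin m) :
    mpartial r (fun z => F z * F' z) y = mpartial r F y * F' y + F y * mpartial r F' y := by
  ext i j
  simp only [mpartial, Matrix.of_apply, Matrix.mul_apply, Matrix.add_apply]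
  rw [partialD_sum fun k _ =>
    (hF.differentiableAt hU hy i k).fun_mul (hF'.differentiableAt hU hy k j),
    ← Finset.sum_add_distrib]
  exact Finset.sum_congr rfl fun k _ =>
    partialD_mul (hF.differentiableAt hU hy i k) (hF'.differentiableAt hU hy k j) r

theorem mpartial_comm (hU : IsOpen U) (hy : y ∈ U) (hF : SmoothEntries U F) (r s : Fin m) :
    mpartial r (mpartial s F) y = mpartial s (mpartial r F) y := by
  ext i j
  exact partialD_comm hU (hF i j) hy r s

end

end MatrixCalculus

namespace CoordFields

variable {m : ℕ} (T : CoordFields m)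

/-- The matrix `(φ^i_j)`. -/
noncomputable def phiMat (y : EuclideanSpace ℝ (Fin m)) : Matrix (Fin m) (Fin m) ℝ :=
  Matrix.of fun i j => T.phi i j y

/-- The column `(ξ^i)`. -/
def xiCol (y : EuclideanSpace ℝ (Fin m)) : Matrix (Fin m) Unit ℝ := Matrix.of fun i _ => T.ξ y i

/-- The row `(η_i) = (ξ^j g_{ji})`. -/
noncomputable def etaRow (y : EuclideanSpace ℝ (Fin m)) : Matrix Unit (Fin m) ℝ :=
  (T.xiCol y)ᵀ * T.gLow y

/-- The connection matrix `Γ_r = (Γ^i_{rj})`. -/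
noncomputable def conn (r : Fin m) (y : EuclideanSpace ℝ (Fin m)) : Matrix (Fin m) (Fin m) ℝ :=
  Matrix.of fun i j => T.christoffel i r j y

/-- The matrix `(∇_r φ^i_j)`. -/
noncomputable def nablaPhiMat (r : Fin m) (y : EuclideanSpace ℝ (Fin m)) :
    Matrix (Fin m) (Fin m) ℝ :=
  Matrix.of fun i j => T.nablaPhi r i j y

/-- The matrix of `∇ξ`, with entry `∇_r ξ^i` in row `i` and column `r`. -/
noncomputable def nablaXiMat (y : EuclideanSpace ℝ (Fin m)) : Matrix (Fin m) (Fin m) ℝ :=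
  Matrix.of fun i r => (mpartial r T.xiCol y + T.conn r y * T.xiCol y) i ()

theorem nablaPhiMat_eq (r : Fin m) (y : EuclideanSpace ℝ (Fin m)) : T.nablaPhiMat r y =
    mpartial r T.phiMat y + T.conn r y * T.phiMat y - T.phiMat y * T.conn r y := by
  ext i j
  simp only [nablaPhiMat, nablaPhi, Matrix.of_apply, Matrix.sub_apply, Matrix.add_apply,
    Matrix.mul_apply, mpartial, conn, phiMat, Finset.sum_sub_distrib, mul_comm (T.phi i _ y)]
  ring

theorem column_nablaXiMat (r : Fin m) (y : EuclideanSpace ℝ (Fin m)) :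
    column (T.nablaXiMat y) r = mpartial r T.xiCol y + T.conn r y * T.xiCol y := rfl

/-- The coordinate expression `T` is, on the open set `U`, a smooth almost paracontact metric
structure with `g(X, φY) = dη(X, Y)`. -/
structure IsParacontactOn (U : Set (EuclideanSpace ℝ (Fin m))) : Prop where
  isOpen : IsOpen U
  smooth_g : SmoothEntries U T.gLow
  smooth_phi : SmoothEntries U T.phiMat
  smooth_xi : SmoothEntries U T.xiCol
  symm : ∀ y ∈ U, (T.gLow y)ᵀ = T.gLow y
  isUnit_det : ∀ y ∈ U, IsUnit (T.gLow y).det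
  phi_xi : ∀ y ∈ U, T.phiMat y * T.xiCol y = 0
  eta_xi : ∀ y ∈ U, T.etaRow y * T.xiCol y = 1
  phi_skew : ∀ y ∈ U, (T.phiMat y)ᵀ * T.gLow y = -(T.gLow y * T.phiMat y)
  phi_sq : ∀ y ∈ U, T.phiMat y * T.phiMat y = 1 - T.xiCol y * T.etaRow y
  etaLow_eq : ∀ y ∈ U, ∀ i, T.etaLow i y = T.etaRow y () i
  contact : ∀ y ∈ U, ∀ i j, (T.gLow y * T.phiMat y) i j =
    1 / 2 * (partialD i (T.etaLow j) y - partialD j (T.etaLow i) y)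

namespace IsParacontactOn

variable {T} {U : Set (EuclideanSpace ℝ (Fin m))} (h : T.IsParacontactOn U)
  {y : EuclideanSpace ℝ (Fin m)}

include h

theorem smooth_gUp : SmoothEntries U T.gUp := h.smooth_g.inv h.isUnit_det

theorem gLow_mul_gUp (hy : y ∈ U) : T.gLow y * T.gUp y = 1 :=
  Matrix.mul_nonsing_inv _ (h.isUnit_det y hy)

theorem smooth_etaRow : SmoothEntries U T.etaRow := h.smooth_xi.transpose.mul h.smooth_g

theorem smooth_conn (r : Fin m) : SmoothEntries U (T.conn r) := fun i j => by
  simp only [conn, Matrix.of_apply, christoffel]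
  refine contDiffOn_const.mul (ContDiffOn.sum fun l _ => (h.smooth_gUp i l).mul
    (((contDiffOn_partialD h.isOpen (h.smooth_g _ _) _).add
      (contDiffOn_partialD h.isOpen (h.smooth_g _ _) _)).sub
      (contDiffOn_partialD h.isOpen (h.smooth_g _ _) _)))

theorem partialD_gLow_symm (hy : y ∈ U) (r i j : Fin m) :
    partialD r (fun z => T.gLow z i j) y = partialD r (fun z => T.gLow z j i) y :=
  partialD_congr h.isOpen (fun z hz => congrFun (congrFun (h.symm z hz) j) i) hy r

/-- The Levi-Civita connection is torsion free. -/
theorem conn_symm (hy : y ∈ U) (i r s : Fin m) : T.conn r y i s = T.conn s y i r := by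
  simp only [conn, Matrix.of_apply, christoffel]
  congr 1
  refine Finset.sum_congr rfl fun l _ => ?_
  rw [h.partialD_gLow_symm hy l r s]; ring

/-- The Levi-Civita connection is metric: `∂_r g_{ij} = Γ^s_{ri} g_{sj} + g_{is} Γ^s_{rj}`. -/
theorem mpartial_gLow (hy : y ∈ U) (r : Fin m) :
    mpartial r T.gLow y = (T.conn r y)ᵀ * T.gLow y + T.gLow y * T.conn r y := by
  have key : ∀ i j l, (T.gLow y * T.conn i y) l j = 1 / 2 *
      (partialD i (fun z => T.gLow z j l) y + partialD j (fun z => T.gLow z i l) y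
      - partialD l (fun z => T.gLow z i j) y) := by
    intro i j l
    have : column (T.conn i y) j = T.gUp y * Matrix.of fun l (_ : Unit) => 1 / 2 *
      (partialD i (fun z => T.gLow z j l) y + partialD j (fun z => T.gLow z i l) y
      - partialD l (fun z => T.gLow z i j) y) := by
      ext k a
      simp only [column, conn, Matrix.of_apply, christoffel, Matrix.mul_apply, Finset.mul_sum]
      exact Finset.sum_congr rfl fun l _ => by ring
    have h2 : T.gLow y * column (T.conn i y) j = Matrix.of fun l (_ : Unit) => 1 / 2 *
      (partialD i (fun z => T.gLow z j l) y + partialD j (fun z => T.gLow z i l) y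
      - partialD l (fun z => T.gLow z i j) y) := by
      rw [this, ← Matrix.mul_assoc, h.gLow_mul_gUp hy, Matrix.one_mul]
    exact congrFun (congrFun h2 l) ()
  have h3 : (T.conn r y)ᵀ * T.gLow y = (T.gLow y * T.conn r y)ᵀ := by
    rw [Matrix.transpose_mul, h.symm y hy]
  rw [h3]
  ext i j
  rw [Matrix.add_apply, Matrix.transpose_apply, key, key, h.partialD_gLow_symm hy r j i,
    h.partialD_gLow_symm hy j r i]
  simp only [mpartial, Matrix.of_apply]
  rw [h.partialD_gLow_symm hy i r j]
  ring

/-- `∇η = g(∇ξ, ·)`. -/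
theorem mpartial_etaRow (hy : y ∈ U) (r : Fin m) : mpartial r T.etaRow y =
    (column (T.nablaXiMat y) r)ᵀ * T.gLow y + T.etaRow y * T.conn r y := by
  have : mpartial r T.etaRow y = mpartial r (fun z => (T.xiCol z)ᵀ) y * T.gLow y +
      (T.xiCol y)ᵀ * mpartial r T.gLow y :=
    mpartial_mul h.isOpen hy h.smooth_xi.transpose h.smooth_g r
  rw [this, mpartial_transpose, h.mpartial_gLow hy, column_nablaXiMat, Matrix.transpose_add,
    Matrix.transpose_mul, Matrix.add_mul, Matrix.mul_add, etaRow]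
  simp only [Matrix.mul_assoc]
  abel

theorem nablaPhi_skew (hy : y ∈ U) (r : Fin m) :
    (T.nablaPhiMat r y)ᵀ * T.gLow y = -(T.gLow y * T.nablaPhiMat r y) := by
  have hd : mpartial r (fun z => (T.phiMat z)ᵀ * T.gLow z + T.gLow z * T.phiMat z) y = 0 := by
    rw [← mpartial_const (0 : Matrix (Fin m) (Fin m) ℝ) r]
    exact mpartial_congr h.isOpen (fun z hz => by rw [h.phi_skew z hz]; abel) hy r
  have hs := h.phi_skew y hy
  rw [mpartial_add h.isOpen hy (h.smooth_phi.transpose.mul h.smooth_g)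
    (h.smooth_g.mul h.smooth_phi), mpartial_mul h.isOpen hy h.smooth_phi.transpose h.smooth_g,
    mpartial_mul h.isOpen hy h.smooth_g h.smooth_phi, mpartial_transpose,
    h.mpartial_gLow hy] at hd
  rw [nablaPhiMat_eq, ← sub_eq_zero, ← hd]
  have e1 : (T.phiMat y)ᵀ * (T.gLow y * T.conn r y) =
      -(T.gLow y * (T.phiMat y * T.conn r y)) := by
    rw [← Matrix.mul_assoc, hs, Matrix.neg_mul, Matrix.mul_assoc]
  simp only [Matrix.transpose_sub, Matrix.transpose_add, Matrix.transpose_mul, Matrix.mul_add,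
    Matrix.add_mul, Matrix.mul_sub, Matrix.sub_mul, Matrix.mul_assoc, hs, e1, Matrix.mul_neg]
  abel

theorem nablaPhi_phi (hy : y ∈ U) (r : Fin m) :
    T.nablaPhiMat r y * T.phiMat y + T.phiMat y * T.nablaPhiMat r y =
      -(column (T.nablaXiMat y) r * T.etaRow y) -
        T.xiCol y * ((column (T.nablaXiMat y) r)ᵀ * T.gLow y) := by
  have hd : mpartial r (fun z => T.phiMat z * T.phiMat z + T.xiCol z * T.etaRow z) y = 0 := by
    rw [← mpartial_const (1 : Matrix (Fin m) (Fin m) ℝ) r]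
    exact mpartial_congr h.isOpen (fun z hz => by rw [h.phi_sq z hz]; abel) hy r
  have hs := h.phi_sq y hy
  rw [mpartial_add h.isOpen hy (h.smooth_phi.mul h.smooth_phi)
    (h.smooth_xi.mul h.smooth_etaRow), mpartial_mul h.isOpen hy h.smooth_phi h.smooth_phi,
    mpartial_mul h.isOpen hy h.smooth_xi h.smooth_etaRow, h.mpartial_etaRow hy] at hd
  rw [nablaPhiMat_eq, ← sub_eq_zero, ← hd]
  have e1 : T.phiMat y * (T.phiMat y * T.conn r y) =
      T.conn r y - T.xiCol y * (T.etaRow y * T.conn r y) := by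
    rw [← Matrix.mul_assoc, hs, Matrix.sub_mul, Matrix.one_mul, Matrix.mul_assoc]
  rw [column_nablaXiMat]
  simp only [Matrix.mul_add, Matrix.add_mul, Matrix.mul_sub, Matrix.sub_mul, Matrix.mul_assoc, hs,
    e1, Matrix.mul_one]
  abel

theorem nablaPhi_xi (hy : y ∈ U) (r : Fin m) :
    T.nablaPhiMat r y * T.xiCol y = -(T.phiMat y * column (T.nablaXiMat y) r) := by
  have hd : mpartial r (fun z => T.phiMat z * T.xiCol z) y = 0 := by
    rw [← mpartial_const (0 : Matrix (Fin m) Unit ℝ) r]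
    exact mpartial_congr h.isOpen (fun z hz => h.phi_xi z hz) hy r
  rw [mpartial_mul h.isOpen hy h.smooth_phi h.smooth_xi] at hd
  rw [nablaPhiMat_eq, ← sub_eq_zero, ← hd, column_nablaXiMat]
  simp only [Matrix.mul_add, Matrix.add_mul, Matrix.sub_mul, Matrix.mul_assoc, h.phi_xi y hy,
    Matrix.mul_zero]
  abel

theorem eta_nablaXi (hy : y ∈ U) : T.etaRow y * T.nablaXiMat y = 0 := by
  ext a r
  have hd : mpartial r (fun z => T.etaRow z * T.xiCol z) y = 0 := by
    rw [← mpartial_const (1 : Matrix Unit Unit ℝ) r]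
    exact mpartial_congr h.isOpen (fun z hz => h.eta_xi z hz) hy r
  rw [mpartial_mul h.isOpen hy h.smooth_etaRow h.smooth_xi, h.mpartial_etaRow hy] at hd
  have e1 : (column (T.nablaXiMat y) r)ᵀ * T.gLow y * T.xiCol y +
      T.etaRow y * column (T.nablaXiMat y) r = 0 := by
    rw [← hd, column_nablaXiMat]
    simp only [Matrix.mul_add, Matrix.add_mul, Matrix.mul_assoc]
    abel
  have e2 : (column (T.nablaXiMat y) r)ᵀ * T.gLow y * T.xiCol y =
      (T.etaRow y * column (T.nablaXiMat y) r)ᵀ := by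
    rw [etaRow, Matrix.transpose_mul, Matrix.transpose_mul, h.symm y hy,
      Matrix.transpose_transpose, Matrix.mul_assoc]
  rw [e2] at e1
  have e3 := congrFun (congrFun e1 ()) ()
  simp only [Matrix.add_apply, Matrix.transpose_apply, Matrix.zero_apply] at e3
  have : (T.etaRow y * T.nablaXiMat y) a r = (T.etaRow y * column (T.nablaXiMat y) r) () () := rfl
  rw [this, Matrix.zero_apply]
  linarith

theorem partialD_etaLow (hy : y ∈ U) (r i : Fin m) : partialD r (T.etaLow i) y =
    (T.gLow y * T.nablaXiMat y) i r + ∑ l, T.etaRow y () l * T.conn r y l i := by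
  have h1 : partialD r (T.etaLow i) y = mpartial r T.etaRow y () i :=
    partialD_congr h.isOpen (fun z hz => h.etaLow_eq z hz i) hy r
  have h2 : ((column (T.nablaXiMat y) r)ᵀ * T.gLow y) () i =
      (T.gLow y * T.nablaXiMat y) i r := by
    rw [Matrix.mul_apply, Matrix.mul_apply]
    refine Finset.sum_congr rfl fun k _ => ?_
    rw [show T.gLow y i k = T.gLow y k i from congrFun (congrFun (h.symm y hy) k) i, mul_comm]
    rfl
  rw [h1, h.mpartial_etaRow hy, Matrix.add_apply, h2, Matrix.mul_apply (M := T.etaRow y)]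

theorem low_phi_skew (hy : y ∈ U) (i j : Fin m) :
    (T.gLow y * T.phiMat y) i j = -(T.gLow y * T.phiMat y) j i := by
  rw [h.contact y hy, h.contact y hy]; ring

theorem nablaEta_skew (hy : y ∈ U) : T.gLow y * T.nablaXiMat y -
    (T.nablaXiMat y)ᵀ * T.gLow y = -(2 : ℝ) • (T.gLow y * T.phiMat y) := by
  have h3 : (T.nablaXiMat y)ᵀ * T.gLow y = (T.gLow y * T.nablaXiMat y)ᵀ := by
    rw [Matrix.transpose_mul, h.symm y hy]
  rw [h3]
  ext i r
  have h1 := h.contact y hy r i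
  rw [h.partialD_etaLow hy, h.partialD_etaLow hy, h.low_phi_skew hy] at h1
  simp only [h.conn_symm hy _ r i] at h1
  simp only [Matrix.sub_apply, Matrix.transpose_apply, Matrix.smul_apply, smul_eq_mul]
  linarith

theorem smooth_etaLow (i : Fin m) : ContDiffOn ℝ ∞ (T.etaLow i) U :=
  (h.smooth_etaRow () i).congr fun z hz => h.etaLow_eq z hz i

/-- `d(dη) = 0` in terms of `∇φ`. -/
theorem nablaPhi_cyclic (hy : y ∈ U) (r s i : Fin m) :
    (T.gLow y * T.nablaPhiMat r y) s i + (T.gLow y * T.nablaPhiMat s y) i r +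
      (T.gLow y * T.nablaPhiMat i y) r s = 0 := by
  have e : ∀ r s i, (T.gLow y * T.nablaPhiMat r y) s i =
      1 / 2 * (partialD r (partialD s (T.etaLow i)) y - partialD r (partialD i (T.etaLow s)) y)
      - ∑ k, T.conn r y k s * (T.gLow y * T.phiMat y) k i
      - ∑ k, T.conn r y k i * (T.gLow y * T.phiMat y) s k := by
    intro r s i
    have e1 : T.gLow y * T.nablaPhiMat r y = mpartial r (fun z => T.gLow z * T.phiMat z) y
        - (T.conn r y)ᵀ * (T.gLow y * T.phiMat y) - (T.gLow y * T.phiMat y) * T.conn r y := by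
      rw [mpartial_mul h.isOpen hy h.smooth_g h.smooth_phi, h.mpartial_gLow hy, nablaPhiMat_eq]
      simp only [Matrix.mul_add, Matrix.add_mul, Matrix.mul_sub, Matrix.mul_assoc]
      abel
    have e2 : mpartial r (fun z => T.gLow z * T.phiMat z) y s i = 1 / 2 *
        (partialD r (partialD s (T.etaLow i)) y - partialD r (partialD i (T.etaLow s)) y) := by
      have d := fun a b => differentiableAt_of_contDiffOn h.isOpen
        (contDiffOn_partialD h.isOpen (h.smooth_etaLow b) a) hy
      have : mpartial r (fun z => T.gLow z * T.phiMat z) y s i = partialD r (fun z => 1 / 2 *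
          (partialD s (T.etaLow i) z - partialD i (T.etaLow s) z)) y :=
        partialD_congr h.isOpen (fun z hz => h.contact z hz s i) hy r
      rw [this, partialD_mul (differentiableAt_const _) ((d s i).fun_sub (d i s)), partialD_const,
        partialD_sub (d s i) (d i s)]
      ring
    rw [e1, Matrix.sub_apply, Matrix.sub_apply, e2, Matrix.mul_apply (M := (T.conn r y)ᵀ),
      Matrix.mul_apply (M := T.gLow y * T.phiMat y)]
    simp only [Matrix.transpose_apply, mul_comm ((T.gLow y * T.phiMat y) s _)]
  have c := fun a b l => partialD_comm h.isOpen (h.smooth_etaLow l) hy a b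
  have s1 : ∀ a b l, ∑ k, T.conn a y k b * (T.gLow y * T.phiMat y) l k =
      -∑ k, T.conn b y k a * (T.gLow y * T.phiMat y) k l := fun a b l => by
    rw [← Finset.sum_neg_distrib]
    exact Finset.sum_congr rfl fun k _ => by
      rw [h.conn_symm hy k a b, h.low_phi_skew hy l k]; ring
  rw [e, e, e, s1 r i s, s1 s r i, s1 i s r, c r s i, c s i r, c i r s]
  ring

/-- The first-order data of a paracontact metric structure at a point. -/
theorem isContactJet (hy : y ∈ U) : IsContactJet (T.gLow y) (T.gUp y) (T.phiMat y) (T.xiCol y)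
    (fun r => T.nablaPhiMat r y) (T.nablaXiMat y) where
  symm := h.symm y hy
  mul_inv := h.gLow_mul_gUp hy
  phi_xi := h.phi_xi y hy
  eta_xi := h.eta_xi y hy
  phi_skew := h.phi_skew y hy
  phi_sq := h.phi_sq y hy
  nabla_skew := h.nablaPhi_skew hy
  nabla_phi_sq := h.nablaPhi_phi hy
  nabla_phi_xi := h.nablaPhi_xi hy
  eta_nabla_xi := h.eta_nablaXi hy
  nabla_eta_skew := h.nablaEta_skew hy
  cyclic := h.nablaPhi_cyclic hy

end IsParacontactOn

end CoordFields

/-! ### Ricci identities and their contractions -/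

namespace CoordFields

variable {m : ℕ} (T : CoordFields m)

/-- The curvature endomorphism `R(∂_r, ∂_s) = (R^l_{rsk})`. -/
noncomputable def curvMat (r s : Fin m) (y : EuclideanSpace ℝ (Fin m)) :
    Matrix (Fin m) (Fin m) ℝ :=
  Matrix.of fun l k => T.curv l r s k y

/-- The covariant derivative `∇_r F` of a field of endomorphisms `F`. -/
noncomputable def covEnd (r : Fin m) (F : EuclideanSpace ℝ (Fin m) → Matrix (Fin m) (Fin m) ℝ)
    (y : EuclideanSpace ℝ (Fin m)) : Matrix (Fin m) (Fin m) ℝ :=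
  mpartial r F y + T.conn r y * F y - F y * T.conn r y

/-- The second covariant derivative `∇_r ∇_s φ^i_j`, as a matrix in `i` and `j`. -/
noncomputable def nabla2Phi (r s : Fin m) (y : EuclideanSpace ℝ (Fin m)) :
    Matrix (Fin m) (Fin m) ℝ :=
  T.covEnd r (T.nablaPhiMat s) y - ∑ k, T.conn r y k s • T.nablaPhiMat k y

theorem curvMat_eq (r s : Fin m) (y : EuclideanSpace ℝ (Fin m)) : T.curvMat r s y =
    mpartial r (T.conn s) y - mpartial s (T.conn r) y + T.conn r y * T.conn s y -
      T.conn s y * T.conn r y := by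
  ext l k
  simp only [curvMat, curv, Matrix.of_apply, Matrix.sub_apply, Matrix.add_apply,
    Matrix.mul_apply, mpartial, conn, Finset.sum_sub_distrib]
  ring

namespace IsParacontactOn

variable {T} {U : Set (EuclideanSpace ℝ (Fin m))} (h : T.IsParacontactOn U)
  {y : EuclideanSpace ℝ (Fin m)}

include h

theorem smooth_nablaPhiMat (r : Fin m) : SmoothEntries U (T.nablaPhiMat r) := by
  rw [show T.nablaPhiMat r = _ from funext (T.nablaPhiMat_eq r)]
  exact ((h.smooth_phi.mpartial h.isOpen r).add ((h.smooth_conn r).mul h.smooth_phi)).sub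
    (h.smooth_phi.mul (h.smooth_conn r))

theorem smooth_nablaXiMat : SmoothEntries U T.nablaXiMat := fun i r =>
  ((h.smooth_xi.mpartial h.isOpen r).add ((h.smooth_conn r).mul h.smooth_xi)) i ()

/-- The Ricci identity for `φ`. -/
theorem nabla2Phi_sub (hy : y ∈ U) (r s : Fin m) : T.nabla2Phi r s y - T.nabla2Phi s r y =
    T.curvMat r s y * T.phiMat y - T.phiMat y * T.curvMat r s y := by
  have e : ∀ r s, mpartial r (T.nablaPhiMat s) y = mpartial r (mpartial s T.phiMat) y +
      (mpartial r (T.conn s) y * T.phiMat y + T.conn s y * mpartial r T.phiMat y) -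
      (mpartial r T.phiMat y * T.conn s y + T.phiMat y * mpartial r (T.conn s) y) := by
    intro r s
    have sΓΦ := (h.smooth_conn s).mul h.smooth_phi
    have sd := h.smooth_phi.mpartial h.isOpen s
    rw [show T.nablaPhiMat s = _ from funext (T.nablaPhiMat_eq s),
      mpartial_sub h.isOpen hy (sd.add sΓΦ) (h.smooth_phi.mul (h.smooth_conn s)),
      mpartial_add h.isOpen hy sd sΓΦ, mpartial_mul h.isOpen hy (h.smooth_conn s) h.smooth_phi,
      mpartial_mul h.isOpen hy h.smooth_phi (h.smooth_conn s)]
  have t : ∑ k, T.conn r y k s • T.nablaPhiMat k y = ∑ k, T.conn s y k r • T.nablaPhiMat k y :=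
    Finset.sum_congr rfl fun k _ => by rw [h.conn_symm hy]
  rw [nabla2Phi, nabla2Phi, t, covEnd, covEnd, e, e, mpartial_comm h.isOpen hy h.smooth_phi r s,
    curvMat_eq, nablaPhiMat_eq, nablaPhiMat_eq]
  noncomm_ring

/-- The Ricci identity for `ξ`. -/
theorem covEnd_nablaXi_sub (hy : y ∈ U) (r s : Fin m) :
    column (T.covEnd r T.nablaXiMat y) s - column (T.covEnd s T.nablaXiMat y) r =
      T.curvMat r s y * T.xiCol y := by
  have e : ∀ r s, column (T.covEnd r T.nablaXiMat y) s =
      mpartial r (mpartial s T.xiCol) y + (mpartial r (T.conn s) y * T.xiCol y +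
        T.conn s y * mpartial r T.xiCol y) +
      T.conn r y * (mpartial s T.xiCol y + T.conn s y * T.xiCol y) -
      T.nablaXiMat y * column (T.conn r y) s := by
    intro r s
    have e1 : column (mpartial r T.nablaXiMat y) s =
        mpartial r (fun z => mpartial s T.xiCol z + T.conn s z * T.xiCol z) y := rfl
    have e2 : column (T.covEnd r T.nablaXiMat y) s = column (mpartial r T.nablaXiMat y) s +
        T.conn r y * column (T.nablaXiMat y) s - T.nablaXiMat y * column (T.conn r y) s := rfl
    rw [e2, e1, mpartial_add h.isOpen hy (h.smooth_xi.mpartial h.isOpen s)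
      ((h.smooth_conn s).mul h.smooth_xi), mpartial_mul h.isOpen hy (h.smooth_conn s) h.smooth_xi,
      column_nablaXiMat]
  have t : column (T.conn r y) s = column (T.conn s y) r := by
    ext k a
    exact h.conn_symm hy k r s
  rw [e, e, t, mpartial_comm h.isOpen hy h.smooth_xi r s, curvMat_eq]
  simp only [Matrix.mul_add, Matrix.add_mul, Matrix.sub_mul, Matrix.mul_assoc]
  abel

theorem trace_covEnd_nablaXi (hy : y ∈ U) (s : Fin m) :
    (T.covEnd s T.nablaXiMat y).trace = 0 := by
  have h1 : (mpartial s T.nablaXiMat y).trace = 0 := by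
    have : partialD s (fun z => ∑ i, T.nablaXiMat z i i) y = 0 := by
      rw [← partialD_const (y := y) 0 s]
      exact partialD_congr h.isOpen (fun z hz => (h.isContactJet hz).trace_nabla_xi) hy s
    rwa [partialD_sum fun i _ => h.smooth_nablaXiMat.differentiableAt h.isOpen hy i i] at this
  rw [covEnd, Matrix.trace_sub, Matrix.trace_add, h1, Matrix.trace_mul_comm (T.conn s y)]
  ring

theorem covEnd_nablaXi_mul_xi (hy : y ∈ U) (r : Fin m) :
    T.covEnd r T.nablaXiMat y * T.xiCol y = -(T.nablaXiMat y * column (T.nablaXiMat y) r) := by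
  have hd : mpartial r (fun z => T.nablaXiMat z * T.xiCol z) y = 0 := by
    rw [← mpartial_const (0 : Matrix (Fin m) Unit ℝ) r]
    exact mpartial_congr h.isOpen (fun z hz => (h.isContactJet hz).nabla_xi_xi) hy r
  rw [mpartial_mul h.isOpen hy h.smooth_nablaXiMat h.smooth_xi] at hd
  rw [covEnd, ← sub_eq_zero, ← hd, column_nablaXiMat]
  simp only [Matrix.mul_add, Matrix.add_mul, Matrix.sub_mul, Matrix.mul_assoc,
    (h.isContactJet hy).nabla_xi_xi, Matrix.mul_zero]
  abel

/-- `Ric(ξ, ξ) = -tr((∇ξ)²)`. -/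
theorem ricci_xi_xi (hy : y ∈ U) : ∑ s, ∑ k, T.xiCol y s () * T.xiCol y k () * T.ricci s k y =
    -(T.nablaXiMat y * T.nablaXiMat y).trace := by
  have e1 : ∑ s, ∑ k, T.xiCol y s () * T.xiCol y k () * T.ricci s k y =
      ∑ r, ∑ s, T.xiCol y s () * (T.curvMat r s y * T.xiCol y) r () := by
    rw [Finset.sum_comm (γ := Fin m) (f := fun r s =>
      T.xiCol y s () * (T.curvMat r s y * T.xiCol y) r ())]
    refine Finset.sum_congr rfl fun s _ => ?_
    simp only [ricci, Matrix.mul_apply, Finset.mul_sum]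
    rw [Finset.sum_comm]
    refine Finset.sum_congr rfl fun r _ => Finset.sum_congr rfl fun k _ => ?_
    simp only [curvMat, Matrix.of_apply]; ring
  have e2 : ∀ r s, (T.curvMat r s y * T.xiCol y) r () =
      T.covEnd r T.nablaXiMat y r s - T.covEnd s T.nablaXiMat y r r := fun r s => by
    rw [← h.covEnd_nablaXi_sub hy]; rfl
  have e3 : ∀ r, ∑ s, T.xiCol y s () * T.covEnd r T.nablaXiMat y r s =
      -(T.nablaXiMat y * T.nablaXiMat y) r r := fun r => by
    have := congrFun (congrFun (h.covEnd_nablaXi_mul_xi hy r) r) ()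
    rw [Matrix.mul_apply] at this
    simp only [mul_comm (T.xiCol y _ _), this]
    rfl
  have e4 : ∑ r, ∑ s, T.xiCol y s () * T.covEnd s T.nablaXiMat y r r = 0 := by
    rw [Finset.sum_comm]
    refine Finset.sum_eq_zero fun s _ => ?_
    have : ∑ r, T.covEnd s T.nablaXiMat y r r = 0 := h.trace_covEnd_nablaXi hy s
    rw [← Finset.mul_sum, this, mul_zero]
  rw [e1]
  simp only [e2, mul_sub, Finset.sum_sub_distrib, e3, e4, Finset.sum_neg_distrib]
  rw [sub_zero]
  rfl

theorem mpartial_gUp (hy : y ∈ U) (r : Fin m) :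
    mpartial r T.gUp y = -(T.conn r y * T.gUp y) - T.gUp y * (T.conn r y)ᵀ := by
  have hd : mpartial r (fun z => T.gLow z * T.gUp z) y = 0 := by
    rw [← mpartial_const (1 : Matrix (Fin m) (Fin m) ℝ) r]
    exact mpartial_congr h.isOpen (fun z hz => h.gLow_mul_gUp hz) hy r
  rw [mpartial_mul h.isOpen hy h.smooth_g h.smooth_gUp, h.mpartial_gLow hy] at hd
  have := congrArg (fun C => T.gUp y * C) hd
  simp only [Matrix.mul_add, Matrix.add_mul, Matrix.mul_assoc, h.gLow_mul_gUp hy, Matrix.mul_one,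
    (h.isContactJet hy).inv_mul_cancel, Matrix.mul_zero] at this
  rw [← sub_eq_zero, ← this]
  abel

/-- The covariant derivative of the bivector `φ^{js}`. -/
theorem mpartial_phi_gUp (hy : y ∈ U) (r : Fin m) :
    mpartial r (fun z => T.phiMat z * T.gUp z) y = T.nablaPhiMat r y * T.gUp y -
      T.conn r y * (T.phiMat y * T.gUp y) - T.phiMat y * T.gUp y * (T.conn r y)ᵀ := by
  rw [mpartial_mul h.isOpen hy h.smooth_phi h.smooth_gUp, h.mpartial_gUp hy, nablaPhiMat_eq]
  noncomm_ring

/-- The covariant derivative of `φ^{js} ∇_s φ^i_j = 0`. -/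
theorem sum_nabla2Phi_phi (hy : y ∈ U) (r i : Fin m) :
    ∑ s, (T.nabla2Phi r s y * (T.phiMat y * T.gUp y) +
      T.nablaPhiMat s y * (T.nablaPhiMat r y * T.gUp y)) i s = 0 := by
  have sB := h.smooth_phi.mul h.smooth_gUp
  have hd : ∑ s, mpartial r (fun z => T.nablaPhiMat s z * (T.phiMat z * T.gUp z)) y i s = 0 := by
    have : partialD r (fun z => ∑ s, (T.nablaPhiMat s z * (T.phiMat z * T.gUp z)) i s) y = 0 := by
      rw [← partialD_const (y := y) 0 r]
      exact partialD_congr h.isOpen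
        (fun z hz => (h.isContactJet hz).sum_nabla_phi_raised i) hy r
    rwa [partialD_sum fun s _ =>
      ((h.smooth_nablaPhiMat s).mul sB).differentiableAt h.isOpen hy i s] at this
  have e : ∀ s, mpartial r (fun z => T.nablaPhiMat s z * (T.phiMat z * T.gUp z)) y =
      (T.nabla2Phi r s y * (T.phiMat y * T.gUp y) +
        T.nablaPhiMat s y * (T.nablaPhiMat r y * T.gUp y)) +
      (∑ k, T.conn r y k s • (T.nablaPhiMat k y * (T.phiMat y * T.gUp y)) -
        T.conn r y * (T.nablaPhiMat s y * (T.phiMat y * T.gUp y)) -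
        T.nablaPhiMat s y * (T.phiMat y * T.gUp y) * (T.conn r y)ᵀ) := by
    intro s
    have e1 : mpartial r (T.nablaPhiMat s) y = T.nabla2Phi r s y +
        ∑ k, T.conn r y k s • T.nablaPhiMat k y - T.conn r y * T.nablaPhiMat s y +
          T.nablaPhiMat s y * T.conn r y := by
      rw [nabla2Phi, covEnd]; abel
    rw [mpartial_mul h.isOpen hy (h.smooth_nablaPhiMat s) sB, e1, h.mpartial_phi_gUp hy]
    simp only [← Matrix.smul_mul, ← Matrix.sum_mul]
    noncomm_ring
  have e2 : ∑ s, (T.conn r y * (T.nablaPhiMat s y * (T.phiMat y * T.gUp y))) i s = 0 := by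
    simp only [Matrix.mul_apply (M := T.conn r y)]
    rw [Finset.sum_comm]
    simp only [← Finset.mul_sum, (h.isContactJet hy).sum_nabla_phi_raised, mul_zero,
      Finset.sum_const_zero]
  have e3 : ∑ s, (T.nablaPhiMat s y * (T.phiMat y * T.gUp y) * (T.conn r y)ᵀ) i s =
      ∑ s, (∑ k, T.conn r y k s • (T.nablaPhiMat k y * (T.phiMat y * T.gUp y))) i s := by
    simp only [Matrix.mul_apply (N := (T.conn r y)ᵀ), Matrix.sum_apply, Matrix.smul_apply,
      smul_eq_mul, Matrix.transpose_apply]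
    rw [Finset.sum_comm]
    exact Finset.sum_congr rfl fun s _ => Finset.sum_congr rfl fun k _ => by ring
  simp only [e] at hd
  simp only [Matrix.add_apply _ (_ - _), Matrix.sub_apply, Finset.sum_add_distrib (g := fun s =>
    _ - _ - _), Finset.sum_sub_distrib, e2, e3] at hd
  linarith

/-- The covariant derivative of `∇_r φ^r_j = 2n η_j`. -/
theorem sum_nabla2Phi_div (hy : y ∈ U) (s j : Fin m) : ∑ r, T.nabla2Phi s r y r j =
    (m - 1) * (T.gLow y * T.nablaXiMat y) j s := by
  have hd : ∑ r, mpartial s (T.nablaPhiMat r) y r j = (m - 1) * mpartial s T.etaRow y () j := by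
    have : partialD s (fun z => ∑ r, T.nablaPhiMat r z r j) y =
        partialD s (fun z => (m - 1) * T.etaRow z () j) y := by
      refine partialD_congr h.isOpen (fun z hz => ?_) hy s
      simpa [etaRow] using (h.isContactJet hz).div_phi j
    rw [partialD_sum fun r _ => (h.smooth_nablaPhiMat r).differentiableAt h.isOpen hy r j,
      partialD_mul (differentiableAt_const _) (h.smooth_etaRow.differentiableAt h.isOpen hy () j),
      partialD_const, zero_mul, zero_add] at this
    exact this
  have e1 : ∀ r, mpartial s (T.nablaPhiMat r) y = T.nabla2Phi s r y +
      (∑ k, T.conn s y k r • T.nablaPhiMat k y - T.conn s y * T.nablaPhiMat r y +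
        T.nablaPhiMat r y * T.conn s y) := fun r => by
    rw [nabla2Phi, covEnd]; abel
  have e2 : ∑ r, (∑ k, T.conn s y k r • T.nablaPhiMat k y) r j =
      ∑ r, (T.conn s y * T.nablaPhiMat r y) r j := by
    simp only [Matrix.mul_apply, Matrix.sum_apply, Matrix.smul_apply, smul_eq_mul]
    exact Finset.sum_comm
  have e3 : ∑ r, (T.nablaPhiMat r y * T.conn s y) r j =
      (m - 1) * (T.etaRow y * T.conn s y) () j := by
    simp only [Matrix.mul_apply (N := T.conn s y), Finset.mul_sum]
    rw [Finset.sum_comm]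
    refine Finset.sum_congr rfl fun l _ => ?_
    rw [← Finset.sum_mul, (h.isContactJet hy).div_phi l, Fintype.card_fin, mul_assoc]
    rfl
  have e4 : ((column (T.nablaXiMat y) s)ᵀ * T.gLow y) () j =
      (T.gLow y * T.nablaXiMat y) j s := by
    have : (column (T.nablaXiMat y) s)ᵀ * T.gLow y = (T.gLow y * column (T.nablaXiMat y) s)ᵀ := by
      rw [Matrix.transpose_mul, h.symm y hy]
    rw [this]; rfl
  rw [h.mpartial_etaRow hy, Matrix.add_apply, e4] at hd
  simp only [e1, Matrix.add_apply, Matrix.sub_apply, Finset.sum_add_distrib,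
    Finset.sum_sub_distrib, e2, e3] at hd
  linarith

theorem scal_eq (hy : y ∈ U) : T.scal y = ∑ r, ∑ s, (T.curvMat r s y * T.gUp y) r s := by
  rw [scal, Finset.sum_comm]
  have : ∑ r, ∑ s, (T.curvMat r s y * T.gUp y) r s =
      ∑ s, ∑ k, ∑ r, T.curv r r s k y * T.gUp y k s := by
    rw [Finset.sum_comm]
    refine Finset.sum_congr rfl fun s _ => ?_
    rw [Finset.sum_comm]
    rfl
  rw [this, Finset.sum_comm]
  refine Finset.sum_congr rfl fun s _ => Finset.sum_congr rfl fun k _ => ?_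
  rw [ricci, Finset.mul_sum, (h.isContactJet hy).inv_symm_apply]
  exact Finset.sum_congr rfl fun r _ => by rw [mul_comm]

theorem scalStar_eq (hy : y ∈ U) : T.scalStar y =
    -∑ r, ∑ s, (T.phiMat y * T.curvMat r s y * (T.phiMat y * T.gUp y)) r s := by
  have J := h.isContactJet hy
  have e : ∀ i p, ∑ j, ∑ s, ∑ l, ∑ k, T.gUp y i j * (T.gUp y p s * T.curvLow p i l k y *
      T.phi l j y * T.phi k s y) =
      -(T.phiMat y * T.curvMat p i y * (T.phiMat y * T.gUp y)) p i := by
    intro i p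
    have e1 : ∑ j, ∑ s, ∑ l, ∑ k, T.gUp y i j * (T.gUp y p s * T.curvLow p i l k y *
        T.phi l j y * T.phi k s y) = ∑ l, ∑ k, (T.gUp y * (T.phiMat y)ᵀ) i l *
          ((T.curvMat p i y)ᵀ * T.gLow y) l k * (T.phiMat y * (T.gUp y)ᵀ) k p := by
      have : ∀ l k, (T.gUp y * (T.phiMat y)ᵀ) i l * ((T.curvMat p i y)ᵀ * T.gLow y) l k *
          (T.phiMat y * (T.gUp y)ᵀ) k p = ∑ j, ∑ s, T.gUp y i j * (T.gUp y p s *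
          T.curvLow p i l k y * T.phi l j y * T.phi k s y) := by
        intro l k
        have c : ((T.curvMat p i y)ᵀ * T.gLow y) l k = T.curvLow p i l k y := rfl
        rw [c, Matrix.mul_apply, Matrix.mul_apply, Finset.sum_mul, Finset.sum_mul]
        refine Finset.sum_congr rfl fun j _ => ?_
        rw [Finset.mul_sum]
        refine Finset.sum_congr rfl fun s _ => ?_
        simp only [phiMat, Matrix.transpose_apply, Matrix.of_apply]
        ring
      simp only [this]
      calc _ = ∑ j, ∑ l, ∑ s, ∑ k, T.gUp y i j * (T.gUp y p s *
            T.curvLow p i l k y * T.phi l j y * T.phi k s y) :=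
            Finset.sum_congr rfl fun j _ => Finset.sum_comm
        _ = ∑ l, ∑ j, ∑ s, ∑ k, T.gUp y i j * (T.gUp y p s *
            T.curvLow p i l k y * T.phi l j y * T.phi k s y) := Finset.sum_comm
        _ = ∑ l, ∑ j, ∑ k, ∑ s, T.gUp y i j * (T.gUp y p s *
            T.curvLow p i l k y * T.phi l j y * T.phi k s y) :=
            Finset.sum_congr rfl fun l _ => Finset.sum_congr rfl fun j _ => Finset.sum_comm
        _ = _ := Finset.sum_congr rfl fun l _ => Finset.sum_comm
    have e2 : ∑ l, ∑ k, (T.gUp y * (T.phiMat y)ᵀ) i l *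
          ((T.curvMat p i y)ᵀ * T.gLow y) l k * (T.phiMat y * (T.gUp y)ᵀ) k p =
        (T.gUp y * (T.phiMat y)ᵀ * ((T.curvMat p i y)ᵀ * T.gLow y) *
          (T.phiMat y * (T.gUp y)ᵀ)) i p := by
      rw [Finset.sum_comm, Matrix.mul_apply]
      refine Finset.sum_congr rfl fun k _ => ?_
      rw [← Finset.sum_mul, Matrix.mul_apply (N := (T.curvMat p i y)ᵀ * T.gLow y)]
    have e3 : T.gLow y * (T.phiMat y * T.gUp y) = -(T.phiMat y)ᵀ := by
      have : T.gLow y * T.phiMat y = -((T.phiMat y)ᵀ * T.gLow y) := by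
        rw [h.phi_skew y hy, neg_neg]
      rw [← Matrix.mul_assoc, this, Matrix.neg_mul, Matrix.mul_assoc, J.mul_inv,
        Matrix.mul_one]
    have e4 : T.gUp y * (T.phiMat y)ᵀ * ((T.curvMat p i y)ᵀ * T.gLow y) *
          (T.phiMat y * (T.gUp y)ᵀ) =
        -(T.phiMat y * T.curvMat p i y * (T.phiMat y * T.gUp y))ᵀ := by
      simp only [Matrix.mul_assoc, e3, Matrix.transpose_mul, J.inv_symm, Matrix.mul_neg]
    rw [e1, e2, e4]; rfl
  rw [scalStar, Finset.sum_comm, ← Finset.sum_neg_distrib]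
  simp only [ricciStar, Finset.mul_sum, ← Finset.sum_neg_distrib, ← e]
  rw [Finset.sum_comm]
  conv_rhs => rw [Finset.sum_comm]
  exact Finset.sum_congr rfl fun i _ => Finset.sum_comm

/-- The Ricci identity for `φ`, contracted with `φ^{js}`:
`scal - Ric(ξ, ξ) + scal* = ½ |∇φ|² - 4n²`. -/
theorem scal_add_scalStar_sub_ricci (hy : y ∈ U) :
    T.scal y - ∑ s, ∑ k, T.xiCol y s () * T.xiCol y k () * T.ricci s k y + T.scalStar y =
      -∑ r, ∑ s, ∑ j, (T.nablaPhiMat r y * T.gUp y) j s * T.nablaPhiMat s y r j -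
        ((m : ℝ) - 1) ^ 2 := by
  have J := h.isContactJet hy
  have l1 : T.scal y - ∑ s, ∑ k, T.xiCol y s () * T.xiCol y k () * T.ricci s k y =
      ∑ r, ∑ s, (T.curvMat r s y * T.phiMat y * (T.phiMat y * T.gUp y)) r s := by
    have e1 : T.phiMat y * (T.phiMat y * T.gUp y) = T.gUp y - T.xiCol y * (T.xiCol y)ᵀ := by
      rw [← Matrix.mul_assoc, h.phi_sq y hy, Matrix.sub_mul, Matrix.one_mul, etaRow,
        Matrix.mul_assoc, J.eta_mul_inv]
    have e2 : ∑ s, ∑ k, T.xiCol y s () * T.xiCol y k () * T.ricci s k y =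
        ∑ r, ∑ s, (T.curvMat r s y * (T.xiCol y * (T.xiCol y)ᵀ)) r s := by
      rw [Finset.sum_comm (γ := Fin m) (f := fun r s =>
        (T.curvMat r s y * (T.xiCol y * (T.xiCol y)ᵀ)) r s)]
      refine Finset.sum_congr rfl fun s _ => ?_
      simp only [ricci, Matrix.mul_apply (M := T.curvMat _ _ _), Finset.mul_sum]
      rw [Finset.sum_comm]
      refine Finset.sum_congr rfl fun r _ => Finset.sum_congr rfl fun k _ => ?_
      simp [curvMat, Matrix.mul_apply]; ring
    rw [h.scal_eq hy, e2, ← Finset.sum_sub_distrib]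
    refine Finset.sum_congr rfl fun r _ => ?_
    rw [← Finset.sum_sub_distrib]
    refine Finset.sum_congr rfl fun s _ => ?_
    rw [Matrix.mul_assoc, e1, Matrix.mul_sub, Matrix.sub_apply]
  have l2 : ∑ r, ∑ s, (T.nabla2Phi r s y * (T.phiMat y * T.gUp y)) r s =
      -∑ r, ∑ s, ∑ j, (T.nablaPhiMat r y * T.gUp y) j s * T.nablaPhiMat s y r j := by
    rw [← Finset.sum_neg_distrib]
    refine Finset.sum_congr rfl fun r _ => ?_
    have e := h.sum_nabla2Phi_phi hy r r
    simp only [Matrix.add_apply, Finset.sum_add_distrib] at e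
    rw [eq_neg_iff_add_eq_zero, ← e]
    congr 1
    refine Finset.sum_congr rfl fun s _ => ?_
    rw [Matrix.mul_apply (M := T.nablaPhiMat s y)]
    exact Finset.sum_congr rfl fun j _ => by ring
  have l3 : ∑ r, ∑ s, (T.nabla2Phi s r y * (T.phiMat y * T.gUp y)) r s = ((m : ℝ) - 1) ^ 2 := by
    have e1 : ∑ r, ∑ s, (T.nabla2Phi s r y * (T.phiMat y * T.gUp y)) r s =
        ∑ s, ∑ j, (∑ r, T.nabla2Phi s r y r j) * (T.phiMat y * T.gUp y) j s := by
      rw [Finset.sum_comm]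
      refine Finset.sum_congr rfl fun s _ => ?_
      simp only [Matrix.mul_apply (M := T.nabla2Phi _ _ _), Finset.sum_mul]
      exact Finset.sum_comm
    have e2 : ((T.phiMat y * T.gUp y)ᵀ * (T.gLow y * T.nablaXiMat y)).trace = (m : ℝ) - 1 := by
      rw [J.inv_mul_skew (h.phi_skew y hy), Matrix.neg_mul, Matrix.trace_neg, Matrix.mul_assoc,
        J.inv_mul_cancel, J.trace_phi_nabla_xi, Fintype.card_fin]
      ring
    have e3 : ∑ s, ∑ j, (T.phiMat y * T.gUp y) j s * (T.gLow y * T.nablaXiMat y) j s =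
        (m : ℝ) - 1 := by
      rw [← e2, Matrix.trace]
      simp only [Matrix.diag_apply, Matrix.mul_apply (M := (T.phiMat y * T.gUp y)ᵀ),
        Matrix.transpose_apply (T.phiMat y * T.gUp y)]
    calc _ = ∑ s, ∑ j, ((m : ℝ) - 1) *
          ((T.phiMat y * T.gUp y) j s * (T.gLow y * T.nablaXiMat y) j s) := by
          rw [e1]
          exact Finset.sum_congr rfl fun s _ => Finset.sum_congr rfl fun j _ => by
            rw [h.sum_nabla2Phi_div hy]; ring
      _ = _ := by simp only [← Finset.mul_sum, e3]; ring
  have l4 : ∀ r s, (T.nabla2Phi r s y * (T.phiMat y * T.gUp y)) r s -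
      (T.nabla2Phi s r y * (T.phiMat y * T.gUp y)) r s =
      (T.curvMat r s y * T.phiMat y * (T.phiMat y * T.gUp y)) r s -
      (T.phiMat y * T.curvMat r s y * (T.phiMat y * T.gUp y)) r s := fun r s => by
    rw [← Matrix.sub_apply, ← Matrix.sub_apply, ← Matrix.sub_mul, ← Matrix.sub_mul,
      h.nabla2Phi_sub hy]
  have l5 := Finset.sum_congr (rfl : (Finset.univ : Finset (Fin m)) = Finset.univ) fun r _ =>
    Finset.sum_congr (rfl : (Finset.univ : Finset (Fin m)) = Finset.univ) fun s _ => l4 r s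
  simp only [Finset.sum_sub_distrib, l2, l3] at l5
  rw [l1, h.scalStar_eq hy, l5, sub_eq_add_neg]

end IsParacontactOn

end CoordFields

/-! ### Component formulas for `h`, `P` and the Nijenhuis tensor -/

section Components

variable {m : ℕ} {y : EuclideanSpace ℝ (Fin m)}

theorem sum_smul_coordVec (v : EuclideanSpace ℝ (Fin m)) : ∑ j, v j • coordVec j = v := by
  ext i
  simp [coordVec, Finset.sum_apply, Pi.single_apply]

theorem clm_apply_eq_sum {F : Type*} [NormedAddCommGroup F] [NormedSpace ℝ F]
    (L : EuclideanSpace ℝ (Fin m) →L[ℝ] F) (v : EuclideanSpace ℝ (Fin m)) :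
    L v = ∑ j, v j • L (coordVec j) := by
  conv_lhs => rw [← sum_smul_coordVec v]
  simp

theorem fderiv_apply_coord {f : EuclideanSpace ℝ (Fin m) → EuclideanSpace ℝ (Fin m)}
    (hf : ∀ i, DifferentiableAt ℝ (fun z => f z i) y) (v : EuclideanSpace ℝ (Fin m))
    (i : Fin m) : (fderiv ℝ f y v) i = fderiv ℝ (fun z => f z i) y v := by
  have h1 : fderiv ℝ (fun z => f z i) y =
      (EuclideanSpace.proj (𝕜 := ℝ) i).comp (fderiv ℝ f y) :=
    ((EuclideanSpace.proj (𝕜 := ℝ) i).hasFDerivAt.comp y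
      (differentiableAt_euclidean.mpr hf).hasFDerivAt).fderiv
  rw [h1]; rfl

theorem fderiv_apply_eq_sum {f : EuclideanSpace ℝ (Fin m) → EuclideanSpace ℝ (Fin m)}
    (hf : ∀ i, DifferentiableAt ℝ (fun z => f z i) y) (v : EuclideanSpace ℝ (Fin m))
    (i : Fin m) : (fderiv ℝ f y v) i = ∑ s, v s * partialD s (fun z => f z i) y := by
  rw [fderiv_apply_coord hf, clm_apply_eq_sum]
  rfl

end Components

namespace CoordFields

variable {m : ℕ} {T : CoordFields m} {y : EuclideanSpace ℝ (Fin m)}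

theorem phi_apply (T : CoordFields m) (y v : EuclideanSpace ℝ (Fin m)) (i : Fin m) :
    (T.φ y v) i = ∑ k, T.phiMat y i k * v k := by
  rw [clm_apply_eq_sum]
  simp [phiMat, phi, Finset.sum_apply, mul_comm]

theorem dEta_coordVec_eq_partialD (T : CoordFields m) (y : EuclideanSpace ℝ (Fin m))
    (r s : Fin m) : T.dEta (fun _ => coordVec r) (fun _ => coordVec s) y =
      1 / 2 * (partialD r (T.etaLow s) y - partialD s (T.etaLow r) y) := by
  rw [dEta]
  simp [VectorField.lieBracket, partialD]
  rfl

namespace IsParacontactOn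

variable {U : Set (EuclideanSpace ℝ (Fin m))} (h : T.IsParacontactOn U)

include h

theorem differentiableAt_phi (hy : y ∈ U) (i j : Fin m) :
    DifferentiableAt ℝ (fun z => T.φ z (coordVec j) i) y :=
  h.smooth_phi.differentiableAt h.isOpen hy i j

/-- The operator `h = ½ L_ξ φ` in terms of `∇φ` and `∇ξ`. -/
theorem hUp_eq (hy : y ∈ U) (i j : Fin m) : T.hUp i j y =
    hMat (T.phiMat y) (T.xiCol y) (fun r => T.nablaPhiMat r y) (T.nablaXiMat y) i j := by
  set dX : Matrix (Fin m) (Fin m) ℝ := Matrix.of fun i s => partialD s (fun z => T.ξ z i) y with hdX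
  set C : Matrix (Fin m) (Fin m) ℝ := ∑ s, T.xiCol y s () • T.conn s y with hC
  have hA : T.nablaXiMat y = dX + C := by
    ext i s
    rw [nablaXiMat, Matrix.of_apply, Matrix.add_apply, Matrix.add_apply]
    congr 1
    rw [Matrix.mul_apply, hC, Matrix.sum_apply]
    refine Finset.sum_congr rfl fun t _ => ?_
    rw [h.conn_symm hy, Matrix.smul_apply, smul_eq_mul, mul_comm]
  have hN : nablaXi (T.xiCol y) (fun r => T.nablaPhiMat r y) =
      ∑ s, T.xiCol y s () • mpartial s T.phiMat y + C * T.phiMat y - T.phiMat y * C := by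
    simp only [nablaXi, nablaPhiMat_eq, hC, Matrix.sum_mul, Matrix.mul_sum, Matrix.smul_mul,
      Matrix.mul_smul, smul_add, smul_sub, Finset.sum_add_distrib, Finset.sum_sub_distrib]
  have hM : hMat (T.phiMat y) (T.xiCol y) (fun r => T.nablaPhiMat r y) (T.nablaXiMat y) =
      (1 / 2 : ℝ) • (∑ s, T.xiCol y s () • mpartial s T.phiMat y - dX * T.phiMat y +
        T.phiMat y * dX) := by
    rw [hMat, hN, hA]
    congr 1
    noncomm_ring
  have dξ : ∀ k, DifferentiableAt ℝ (fun z => T.ξ z k) y := fun k =>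
    h.smooth_xi.differentiableAt h.isOpen hy k ()
  have e1 : ∀ k, (VectorField.lieBracket ℝ T.ξ (fun _ => coordVec j) y) k = -dX k j := by
    intro k
    have := fderiv_apply_coord dξ (coordVec j) k
    simp [VectorField.lieBracket, this, hdX, partialD]
  have e2 : (VectorField.lieBracket ℝ T.ξ (fun z => T.φ z (coordVec j)) y) i =
      ∑ s, T.xiCol y s () * mpartial s T.phiMat y i j - ∑ s, dX i s * T.phiMat y s j := by
    have f1 := fderiv_apply_eq_sum (h.differentiableAt_phi hy · j) (T.ξ y) i
    have f2 := fderiv_apply_eq_sum dξ (T.φ y (coordVec j)) i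
    rw [VectorField.lieBracket, PiLp.sub_apply, f1, f2]
    congr 1
    exact Finset.sum_congr rfl fun s _ => mul_comm _ _
  rw [hM, hUp, PiLp.sub_apply, phi_apply, e2]
  simp only [e1]
  simp only [Matrix.smul_apply, Matrix.add_apply, Matrix.sub_apply, Matrix.sum_apply,
    Matrix.mul_apply, smul_eq_mul, mul_neg, Finset.sum_neg_distrib]
  ring

theorem hLow_eq (hy : y ∈ U) (i j : Fin m) : T.hLow i j y = (T.gLow y *
    hMat (T.phiMat y) (T.xiCol y) (fun r => T.nablaPhiMat r y) (T.nablaXiMat y)) i j := by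
  rw [hLow, Matrix.mul_apply]
  exact Finset.sum_congr rfl fun r _ => by rw [h.hUp_eq hy]

theorem normSqH_eq (hy : y ∈ U) :
    T.normSqH y = (m - 1) - (T.nablaXiMat y * T.nablaXiMat y).trace := by
  have := (h.isContactJet hy).norm_hMat
  rw [Fintype.card_fin] at this
  rw [← this, normSqH]
  simp only [h.hLow_eq hy]

theorem normSqNablaPhi_eq (hy : y ∈ U) : T.normSqNablaPhi y = ∑ r, ∑ s, ∑ i,
    (T.gLow y * T.nablaPhiMat r y) s i *
      (∑ a, T.gUp y r a • (T.nablaPhiMat a y * T.gUp y)) s i :=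
  (h.isContactJet hy).norm_nabla_phi

theorem tensorP_eq (hy : y ∈ U) (r s i : Fin m) : T.tensorP r s i y =
    (T.gLow y * T.nablaPhiMat r y) s i - ((T.xiCol y)ᵀ * T.gLow y) () i * T.gLow y r s +
      ((T.xiCol y)ᵀ * T.gLow y) () s * T.gLow y r i := by
  rw [tensorP, h.etaLow_eq y hy, h.etaLow_eq y hy]
  rfl

/-- `|P|² = |∇φ|² - 4n`. -/
theorem normSqP_eq (hy : y ∈ U) : T.normSqP y = T.normSqNablaPhi y - 2 * (m - 1) := by
  have := (h.isContactJet hy).norm_tensorP (fun r s i => T.tensorP r s i y) (h.tensorP_eq hy)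
  rw [Fintype.card_fin] at this
  rw [h.normSqNablaPhi_eq hy]
  exact this

/-- `scal + scal* + 4n² = |h|² + ½ |∇φ|² - 2n`. -/
theorem scal_add_scalStar (hy : y ∈ U) : T.scal y + T.scalStar y + ((m : ℝ) - 1) ^ 2 =
    T.normSqH y + 1 / 2 * T.normSqNablaPhi y - (m - 1) := by
  have h1 := h.scal_add_scalStar_sub_ricci hy
  rw [h.ricci_xi_xi hy, (h.isContactJet hy).sum_nabla_phi_nabla_phi,
    ← h.normSqNablaPhi_eq hy] at h1
  rw [h.normSqH_eq hy]
  linarith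

theorem dEta_coordVec (hy : y ∈ U) (r s : Fin m) :
    T.dEta (fun _ => coordVec r) (fun _ => coordVec s) y = (T.gLow y * T.phiMat y) r s := by
  rw [h.contact y hy, dEta_coordVec_eq_partialD]

/-- The components of the Nijenhuis tensor in terms of `∇φ`. -/
theorem nijenhuis_coordVec (hy : y ∈ U) (r s i : Fin m) :
    (T.nijenhuis (fun _ => coordVec r) (fun _ => coordVec s) y) i =
      ∑ k, (T.phiMat y k r * T.nablaPhiMat k y i s - T.phiMat y k s * T.nablaPhiMat k y i r) +
      (T.phiMat y * T.nablaPhiMat s y) i r - (T.phiMat y * T.nablaPhiMat r y) i s := by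
  have b1 : (VectorField.lieBracket ℝ (fun z => T.φ z (coordVec r))
      (fun z => T.φ z (coordVec s)) y) i = ∑ k, (T.phiMat y k r * mpartial k T.phiMat y i s -
        T.phiMat y k s * mpartial k T.phiMat y i r) := by
    have f1 := fderiv_apply_eq_sum (h.differentiableAt_phi hy · s) (T.φ y (coordVec r)) i
    have f2 := fderiv_apply_eq_sum (h.differentiableAt_phi hy · r) (T.φ y (coordVec s)) i
    rw [VectorField.lieBracket, PiLp.sub_apply, f1, f2, ← Finset.sum_sub_distrib]
    rfl
  have b2 : ∀ k, (VectorField.lieBracket ℝ (fun z => T.φ z (coordVec r))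
      (fun _ => coordVec s) y) k = -mpartial s T.phiMat y k r := by
    intro k
    have := fderiv_apply_coord (h.differentiableAt_phi hy · r) (coordVec s) k
    simp [VectorField.lieBracket, this]
    rfl
  have b3 : ∀ k, (VectorField.lieBracket ℝ (fun _ => coordVec r)
      (fun z => T.φ z (coordVec s)) y) k = mpartial r T.phiMat y k s := by
    intro k
    have := fderiv_apply_coord (h.differentiableAt_phi hy · s) (coordVec r) k
    simp [VectorField.lieBracket, this]
    rfl
  have b4 : VectorField.lieBracket ℝ (fun _ : EuclideanSpace ℝ (Fin m) => coordVec r)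
      (fun _ => coordVec s) y = 0 := by
    simp [VectorField.lieBracket]
  rw [nijenhuis, b4]
  simp only [map_zero, add_zero, PiLp.sub_apply, phi_apply, b1, b2, b3]
  -- The Christoffel symbols cancel, since the connection is torsion free.
  have c1 : ∑ k, (T.phiMat y k r * (T.conn k y * T.phiMat y) i s -
      T.phiMat y k s * (T.conn k y * T.phiMat y) i r) = 0 := by
    simp only [Matrix.mul_apply, Finset.mul_sum, Finset.sum_sub_distrib]
    rw [sub_eq_zero, Finset.sum_comm]
    exact Finset.sum_congr rfl fun k _ => Finset.sum_congr rfl fun l _ => by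
      rw [h.conn_symm hy i k l]; ring
  have c2 : ∀ r s, ∑ k, T.phiMat y k r * (T.phiMat y * T.conn k y) i s =
      (T.phiMat y * (T.conn s y * T.phiMat y)) i r := fun r s => by
    simp only [Matrix.mul_apply, Finset.mul_sum]
    rw [Finset.sum_comm]
    exact Finset.sum_congr rfl fun k _ => Finset.sum_congr rfl fun l _ => by
      rw [h.conn_symm hy k l s]; ring
  have c3 : (T.phiMat y * (T.phiMat y * T.conn s y)) i r =
      (T.phiMat y * (T.phiMat y * T.conn r y)) i s := by
    rw [← Matrix.mul_assoc, ← Matrix.mul_assoc, Matrix.mul_apply, Matrix.mul_apply]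
    exact Finset.sum_congr rfl fun k _ => by rw [h.conn_symm hy]
  have c4 : ∀ r s, ∑ k, T.phiMat y i k * mpartial r T.phiMat y k s =
      (T.phiMat y * mpartial r T.phiMat y) i s := fun r s => (Matrix.mul_apply).symm
  simp only [Finset.sum_sub_distrib] at c1
  simp only [nablaPhiMat_eq, Matrix.add_apply, Matrix.sub_apply,
    mul_add, mul_sub, Finset.sum_add_distrib, Finset.sum_sub_distrib, c2, c3, c4, mul_neg,
    Finset.sum_neg_distrib]
  linarith

/-- For a normal structure `h = 0` and `P = 0`, so that `scal + scal* + 4n² = 0`. -/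
theorem scal_add_scalStar_of_normal (hy : y ∈ U)
    (hN : ∀ r s, T.nijenhuis (fun _ => coordVec r) (fun _ => coordVec s) y -
      (2 * T.dEta (fun _ => coordVec r) (fun _ => coordVec s) y) • T.ξ y = 0) :
    T.scal y + T.scalStar y + ((m : ℝ) - 1) ^ 2 = 0 := by
  have J := h.isContactJet hy
  have hN' : ∀ r s i, ∑ k, (T.phiMat y k r * T.nablaPhiMat k y i s -
      T.phiMat y k s * T.nablaPhiMat k y i r) + (T.phiMat y * T.nablaPhiMat s y) i r -
        (T.phiMat y * T.nablaPhiMat r y) i s =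
      2 * (T.gLow y * T.phiMat y) r s * T.xiCol y i () := fun r s i => by
    rw [← h.nijenhuis_coordVec hy, ← h.dEta_coordVec hy, sub_eq_zero.mp (hN r s)]
    rfl
  have h1 : T.normSqH y = 0 := by
    rw [normSqH]
    simp [h.hLow_eq hy, J.hMat_eq_zero hN']
  have h2 : T.normSqP y = 0 := by
    have : ∀ r s i, T.tensorP r s i y = 0 := fun r s i => by
      rw [h.tensorP_eq hy, J.low_nabla_phi_of_normal hN']; ring
    simp [normSqP, normSq₃, this]
  have h3 := h.scal_add_scalStar hy
  have h4 := h.normSqP_eq hy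
  rw [h3, h1]
  linarith

end IsParacontactOn

end CoordFields

/-! ### Passage to charts -/

namespace CoordFields

variable {m : ℕ} (T : CoordFields m)

theorem sum_mul_gLow (y u : EuclideanSpace ℝ (Fin m)) (j : Fin m) :
    ∑ k, u k * T.gLow y k j = T.g y u (coordVec j) := by
  rw [clm_apply_eq_sum (T.g y) u]
  simp [gLow]

theorem sum_gLow_mul (y v : EuclideanSpace ℝ (Fin m)) (i : Fin m) :
    ∑ k, T.gLow y i k * v k = T.g y (coordVec i) v := by
  rw [clm_apply_eq_sum (T.g y (coordVec i)) v]
  simp [gLow, mul_comm]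

/-- The coordinate-free identities of an almost paracontact metric structure, in matrix form. -/
theorem isParacontactOn_of_apply {U : Set (EuclideanSpace ℝ (Fin m))} (hU : IsOpen U)
    (smooth_g : ∀ i j, ContDiffOn ℝ ∞ (fun y => T.gLow y i j) U)
    (smooth_φ : ∀ i j, ContDiffOn ℝ ∞ (T.phi i j) U)
    (smooth_ξ : ∀ i, ContDiffOn ℝ ∞ (fun y => T.ξ y i) U)
    (g_symm : ∀ y ∈ U, ∀ v w, T.g y v w = T.g y w v)
    (g_nondegenerate : ∀ y ∈ U, ∀ v, (∀ w, T.g y v w = 0) → v = 0)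
    (φ_ξ : ∀ y ∈ U, T.φ y (T.ξ y) = 0)
    (η_φ : ∀ y ∈ U, ∀ v, T.η y (T.φ y v) = 0)
    (η_ξ : ∀ y ∈ U, T.η y (T.ξ y) = 1)
    (φ_φ : ∀ y ∈ U, ∀ v, T.φ y (T.φ y v) = v - T.η y v • T.ξ y)
    (g_compatible : ∀ y ∈ U, ∀ v w, T.g y (T.φ y v) (T.φ y w) =
      -T.g y v w + T.η y v * T.η y w)
    (contact : ∀ y ∈ U, ∀ i j, T.g y (coordVec i) (T.φ y (coordVec j)) =
      T.dEta (fun _ => coordVec i) (fun _ => coordVec j) y) :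
    T.IsParacontactOn U := by
  have g_ξ : ∀ y ∈ U, ∀ w, T.g y (T.ξ y) w = T.η y w := fun y hy w => by
    have := g_compatible y hy (T.ξ y) w
    rw [φ_ξ y hy, η_ξ y hy] at this
    simp at this
    linarith
  have skew : ∀ y ∈ U, ∀ v w, T.g y (T.φ y v) w = -T.g y v (T.φ y w) := fun y hy v w => by
    have h1 := g_compatible y hy v (T.φ y w)
    rw [φ_φ y hy, η_φ y hy, map_sub, map_smul, g_symm y hy _ (T.ξ y), g_ξ y hy, η_φ y hy] at h1
    simpa using h1
  have etaRow_apply : ∀ y ∈ U, ∀ i, T.etaRow y () i = T.etaLow i y := fun y hy i => by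
    rw [etaLow, ← g_ξ y hy, ← sum_mul_gLow]
    rfl
  refine ⟨hU, smooth_g, smooth_φ, fun i _ => smooth_ξ i, ?_, ?_, ?_, ?_, ?_, ?_, ?_, ?_⟩
  · intro y hy
    ext i j
    exact g_symm y hy _ _
  · intro y hy
    rw [isUnit_iff_ne_zero]
    intro h0
    obtain ⟨v, hv, hv0⟩ := Matrix.exists_mulVec_eq_zero_iff.mpr h0
    refine hv ?_
    have : WithLp.toLp 2 v = 0 := by
      refine g_nondegenerate y hy _ fun w => ?_
      rw [g_symm y hy, clm_apply_eq_sum (T.g y) w]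
      simp only [_root_.sum_apply, _root_.smul_apply]
      refine Finset.sum_eq_zero fun i _ => ?_
      rw [← sum_gLow_mul]
      have := congrFun hv0 i
      rw [Matrix.mulVec, dotProduct] at this
      simp [this]
    exact congrArg WithLp.ofLp this
  · intro y hy
    ext i a
    have := congrArg (fun v => v i) (φ_ξ y hy)
    simp only [phi_apply] at this
    exact this
  · intro y hy
    ext a b
    rw [Matrix.mul_apply, Matrix.one_apply_eq, ← η_ξ y hy, clm_apply_eq_sum (T.η y) (T.ξ y)]
    refine Finset.sum_congr rfl fun i _ => ?_
    rw [etaRow_apply y hy, smul_eq_mul, mul_comm]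
    rfl
  · intro y hy
    ext i j
    have h1 : ((T.phiMat y)ᵀ * T.gLow y) i j = T.g y (T.φ y (coordVec i)) (coordVec j) := by
      rw [← sum_mul_gLow]; rfl
    have h2 : (T.gLow y * T.phiMat y) i j = T.g y (coordVec i) (T.φ y (coordVec j)) := by
      rw [← sum_gLow_mul]; rfl
    rw [h1, skew y hy, Matrix.neg_apply, h2]
  · intro y hy
    ext i j
    have h1 : (T.phiMat y * T.phiMat y) i j = (T.φ y (T.φ y (coordVec j))) i := by
      rw [phi_apply]; rfl
    have h2 : (T.xiCol y * T.etaRow y) i j = T.ξ y i * T.etaLow j y := by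
      rw [← etaRow_apply y hy, Matrix.mul_apply]; simp [xiCol]
    rw [h1, φ_φ y hy, Matrix.sub_apply, h2, Matrix.one_apply]
    simp [coordVec, etaLow, mul_comm]
  · intro y hy i
    exact (etaRow_apply y hy i).symm
  · intro y hy i j
    rw [← dEta_coordVec_eq_partialD, ← contact y hy, ← sum_gLow_mul]
    rfl

end CoordFields

section Charts

variable {n : ℕ} {M : Type*} [TopologicalSpace M]
  [ChartedSpace (EuclideanSpace ℝ (Fin (2 * n + 1))) M]
  {e : OpenPartialHomeomorph M (EuclideanSpace ℝ (Fin (2 * n + 1)))}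

theorem mdifferentiable_of_mem_maximalAtlas
    (he : e ∈ IsManifold.maximalAtlas (𝓡 (2 * n + 1)) ∞ M) :
    e.MDifferentiable (𝓡 (2 * n + 1)) (𝓡 (2 * n + 1)) :=
  ⟨(contMDiffOn_of_mem_maximalAtlas he).mdifferentiableOn (by simp),
    (contMDiffOn_symm_of_mem_maximalAtlas he).mdifferentiableOn (by simp)⟩

theorem mfderiv_symm_mfderiv (he : e ∈ IsManifold.maximalAtlas (𝓡 (2 * n + 1)) ∞ M)
    {y : EuclideanSpace ℝ (Fin (2 * n + 1))} (hy : y ∈ e.target)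
    (v : TangentSpace (𝓡 (2 * n + 1)) (e.symm y)) :
    mfderiv (𝓡 (2 * n + 1)) (𝓡 (2 * n + 1)) e.symm y
      (mfderiv (𝓡 (2 * n + 1)) (𝓡 (2 * n + 1)) e (e.symm y) v) = v := by
  have := (mdifferentiable_of_mem_maximalAtlas he).symm_comp_deriv (e.map_target hy)
  rw [e.right_inv hy] at this
  exact congrArg (fun L => L v) this

theorem mfderiv_mfderiv_symm (he : e ∈ IsManifold.maximalAtlas (𝓡 (2 * n + 1)) ∞ M)
    {y : EuclideanSpace ℝ (Fin (2 * n + 1))} (hy : y ∈ e.target)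
    (v : EuclideanSpace ℝ (Fin (2 * n + 1))) :
    mfderiv (𝓡 (2 * n + 1)) (𝓡 (2 * n + 1)) e (e.symm y)
      (mfderiv (𝓡 (2 * n + 1)) (𝓡 (2 * n + 1)) e.symm y v) = v := by
  have := (mdifferentiable_of_mem_maximalAtlas he).comp_symm_deriv hy
  exact congrArg (fun L => L v) this

variable [IsManifold (𝓡 (2 * n + 1)) ∞ M]

/-- A coordinate vector field, as a section of `TM` along the inverse chart, is smooth. -/
theorem contMDiffOn_mfderiv_symm_const (he : e ∈ IsManifold.maximalAtlas (𝓡 (2 * n + 1)) ∞ M)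
    (u : EuclideanSpace ℝ (Fin (2 * n + 1))) :
    ContMDiffOn (𝓡 (2 * n + 1)) (𝓡 (2 * n + 1)).tangent ∞
      (fun y => (Bundle.TotalSpace.mk' (EuclideanSpace ℝ (Fin (2 * n + 1))) (e.symm y)
        (mfderiv (𝓡 (2 * n + 1)) (𝓡 (2 * n + 1)) e.symm y u) :
        TangentBundle (𝓡 (2 * n + 1)) M)) e.target := by
  have h1 := (contMDiffOn_symm_of_mem_maximalAtlas he).contMDiffOn_tangentMapWithin (m := ∞)
    (by simp) e.open_target.uniqueMDiffOn
  have h2 : ContMDiff (𝓡 (2 * n + 1)) (𝓡 (2 * n + 1)).tangent ∞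
      (fun y => (Bundle.TotalSpace.mk' (EuclideanSpace ℝ (Fin (2 * n + 1))) y u :
        TangentBundle (𝓡 (2 * n + 1)) (EuclideanSpace ℝ (Fin (2 * n + 1))))) :=
    contMDiff_vectorSpace_iff_contDiff.mpr contDiff_const
  refine (h1.comp (s := e.target) h2.contMDiffOn fun y hy => hy).congr fun y hy => ?_
  simp [tangentMapWithin, mfderivWithin_of_isOpen e.open_target hy]

/-- The chart representation of a smooth vector field along the inverse chart is smooth. -/
theorem contDiffOn_mfderiv_apply (he : e ∈ IsManifold.maximalAtlas (𝓡 (2 * n + 1)) ∞ M)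
    (V : Π y : EuclideanSpace ℝ (Fin (2 * n + 1)), TangentSpace (𝓡 (2 * n + 1)) (e.symm y))
    (hV : ContMDiffOn (𝓡 (2 * n + 1)) (𝓡 (2 * n + 1)).tangent ∞
      (fun y => (Bundle.TotalSpace.mk' (EuclideanSpace ℝ (Fin (2 * n + 1))) (e.symm y) (V y) :
        TangentBundle (𝓡 (2 * n + 1)) M)) e.target) :
    ContDiffOn ℝ ∞ (fun y => (mfderiv (𝓡 (2 * n + 1)) (𝓡 (2 * n + 1)) e (e.symm y) (V y) :
      EuclideanSpace ℝ (Fin (2 * n + 1)))) e.target := by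
  refine contMDiffOn_iff_contDiffOn.mp fun y hy => ?_
  have h1 := (contMDiffOn_of_mem_maximalAtlas he).contMDiffOn_tangentMapWithin (m := ∞)
    (by simp) e.open_source.uniqueMDiffOn
  have h2 := h1.comp (s := e.target) hV (fun y hy => e.map_target hy) y hy
  rw [Bundle.contMDiffWithinAt_totalSpace] at h2
  have h3 : ∀ z ∈ e.target, mfderiv (𝓡 (2 * n + 1)) (𝓡 (2 * n + 1)) e (e.symm z) =
      mfderivWithin (𝓡 (2 * n + 1)) (𝓡 (2 * n + 1)) e e.source (e.symm z) := fun z hz =>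
    (mfderivWithin_of_isOpen e.open_source (e.map_target hz)).symm
  refine h2.2.congr (fun z hz => ?_) ?_
  · simp [tangentMapWithin, h3 z hz]
    rfl
  · simp [tangentMapWithin, h3 y hy]
    rfl

variable (S : AlmostParacontactMetric n M)

theorem contDiffOn_inChart_g (he : e ∈ IsManifold.maximalAtlas (𝓡 (2 * n + 1)) ∞ M)
    (u v : EuclideanSpace ℝ (Fin (2 * n + 1))) :
    ContDiffOn ℝ ∞ (fun y => (S.inChart e).g y u v) e.target := by
  rw [← contMDiffOn_iff_contDiffOn]
  intro y hy
  have h1 := S.smooth_g.comp_contMDiffOn (contMDiffOn_symm_of_mem_maximalAtlas he) y hy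
  have h2 := h1.clm_bundle_apply₂ (E₃ := fun _ : M => ℝ) (F₃ := ℝ)
    (contMDiffOn_mfderiv_symm_const he u y hy) (contMDiffOn_mfderiv_symm_const he v y hy)
  rw [Bundle.contMDiffWithinAt_totalSpace] at h2
  exact h2.2

theorem contDiffOn_inChart_ξ (he : e ∈ IsManifold.maximalAtlas (𝓡 (2 * n + 1)) ∞ M) :
    ContDiffOn ℝ ∞ (S.inChart e).ξ e.target :=
  contDiffOn_mfderiv_apply he (fun y => S.ξ (e.symm y))
    (S.smooth_ξ.comp_contMDiffOn (contMDiffOn_symm_of_mem_maximalAtlas he))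

theorem contDiffOn_inChart_φ (he : e ∈ IsManifold.maximalAtlas (𝓡 (2 * n + 1)) ∞ M)
    (u : EuclideanSpace ℝ (Fin (2 * n + 1))) :
    ContDiffOn ℝ ∞ (fun y => (S.inChart e).φ y u) e.target := by
  refine contDiffOn_mfderiv_apply he
    (fun y => S.φ (e.symm y) (mfderiv (𝓡 (2 * n + 1)) (𝓡 (2 * n + 1)) e.symm y u)) fun y hy => ?_
  exact (S.smooth_φ.comp_contMDiffOn (contMDiffOn_symm_of_mem_maximalAtlas he) y
    hy).clm_bundle_apply (contMDiffOn_mfderiv_symm_const he u y hy)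

/-- In any chart of a paracontact metric manifold the structure tensors are smooth and satisfy the
structure equations on the whole chart domain. -/
theorem isParacontactOn_inChart (hS : S.IsParacontact)
    (he : e ∈ IsManifold.maximalAtlas (𝓡 (2 * n + 1)) ∞ M) :
    (S.inChart e).IsParacontactOn e.target := by
  refine (S.inChart e).isParacontactOn_of_apply e.open_target
    (fun i j => contDiffOn_inChart_g S he _ _)
    (fun i j => contDiffOn_euclidean.mp (contDiffOn_inChart_φ S he (coordVec j)) i)
    (fun i => contDiffOn_euclidean.mp (contDiffOn_inChart_ξ S he) i)
    (fun y _ v w => S.g_symm _ _ _) ?_ ?_ ?_ ?_ ?_ ?_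
    (fun y hy i j => hS e he _ _ contDiffOn_const contDiffOn_const y hy)
  · intro y hy v hv
    have h1 : mfderiv (𝓡 (2 * n + 1)) (𝓡 (2 * n + 1)) e.symm y v = 0 := by
      refine S.g_nondegenerate _ _ fun w => ?_
      rw [← mfderiv_symm_mfderiv he hy w]
      exact hv _
    rw [← mfderiv_mfderiv_symm he hy v, h1]
    exact map_zero _
  · intro y hy
    change mfderiv (𝓡 (2 * n + 1)) (𝓡 (2 * n + 1)) e (e.symm y) (S.φ (e.symm y)
      (mfderiv (𝓡 (2 * n + 1)) (𝓡 (2 * n + 1)) e.symm y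
        (mfderiv (𝓡 (2 * n + 1)) (𝓡 (2 * n + 1)) e (e.symm y) (S.ξ (e.symm y))))) = 0
    rw [mfderiv_symm_mfderiv he hy, S.φ_ξ]
    exact map_zero _
  · intro y hy v
    change S.η (e.symm y) (mfderiv (𝓡 (2 * n + 1)) (𝓡 (2 * n + 1)) e.symm y
      (mfderiv (𝓡 (2 * n + 1)) (𝓡 (2 * n + 1)) e (e.symm y) (S.φ (e.symm y) _))) = 0
    rw [mfderiv_symm_mfderiv he hy, S.η_φ]
  · intro y hy
    change S.η (e.symm y) (mfderiv (𝓡 (2 * n + 1)) (𝓡 (2 * n + 1)) e.symm y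
      (mfderiv (𝓡 (2 * n + 1)) (𝓡 (2 * n + 1)) e (e.symm y) (S.ξ (e.symm y)))) = 1
    rw [mfderiv_symm_mfderiv he hy, S.η_ξ]
  · intro y hy v
    change mfderiv (𝓡 (2 * n + 1)) (𝓡 (2 * n + 1)) e (e.symm y) (S.φ (e.symm y)
      (mfderiv (𝓡 (2 * n + 1)) (𝓡 (2 * n + 1)) e.symm y
        (mfderiv (𝓡 (2 * n + 1)) (𝓡 (2 * n + 1)) e (e.symm y) (S.φ (e.symm y)
          (mfderiv (𝓡 (2 * n + 1)) (𝓡 (2 * n + 1)) e.symm y v))))) =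
      v - (S.inChart e).η y v • (S.inChart e).ξ y
    rw [mfderiv_symm_mfderiv he hy, S.φ_φ, map_sub, map_smul, mfderiv_mfderiv_symm he hy]
    rfl
  · intro y hy v w
    change S.g (e.symm y) (mfderiv (𝓡 (2 * n + 1)) (𝓡 (2 * n + 1)) e.symm y
      (mfderiv (𝓡 (2 * n + 1)) (𝓡 (2 * n + 1)) e (e.symm y) (S.φ (e.symm y) _)))
      (mfderiv (𝓡 (2 * n + 1)) (𝓡 (2 * n + 1)) e.symm y
      (mfderiv (𝓡 (2 * n + 1)) (𝓡 (2 * n + 1)) e (e.symm y) (S.φ (e.symm y) _))) = _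
    rw [mfderiv_symm_mfderiv he hy, mfderiv_symm_mfderiv he hy, S.g_compatible]
    rfl

end Charts

end Paracontact

theorem corollaryc2 {n : ℕ} {M : Type*} [TopologicalSpace M]
    [ChartedSpace (EuclideanSpace ℝ (Fin (2 * n + 1))) M] [IsManifold (𝓡 (2 * n + 1)) ∞ M]
    (S : Paracontact.AlmostParacontactMetric n M) (hS : S.IsParacontact) :
    (∀ e ∈ IsManifold.maximalAtlas (𝓡 (2 * n + 1)) ∞ M, ∀ x ∈ e.source,
      (S.inChart e).scal (e x) + (S.inChart e).scalStar (e x) + 4 * (n : ℝ) ^ 2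
          = (S.inChart e).normSqH (e x) + 1 / 2 * (S.inChart e).normSqNablaPhi (e x) - 2 * (n : ℝ)
        ∧ (S.inChart e).normSqP (e x) = (S.inChart e).normSqNablaPhi (e x) - 4 * (n : ℝ))
    ∧ (S.IsParaSasakian →
      ∀ e ∈ IsManifold.maximalAtlas (𝓡 (2 * n + 1)) ∞ M, ∀ x ∈ e.source,
        (S.inChart e).scal (e x) + (S.inChart e).scalStar (e x) + 4 * (n : ℝ) ^ 2 = 0) := by
  have hn : ((2 * n + 1 : ℕ) : ℝ) - 1 = 2 * n := by push_cast; ring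
  refine ⟨fun e he x hx => ?_, fun hN e he x hx => ?_⟩
  · have h := Paracontact.isParacontactOn_inChart S hS he
    have h1 := h.scal_add_scalStar (e.map_source hx)
    have h2 := h.normSqP_eq (e.map_source hx)
    rw [hn] at h1 h2
    exact ⟨by linarith, by linarith⟩
  · have h := Paracontact.isParacontactOn_inChart S hS he
    have h1 := h.scal_add_scalStar_of_normal (e.map_source hx) fun r s =>
      hN.2 e he _ _ contDiffOn_const contDiffOn_const _ (e.map_source hx)
    rw [hn] at h1
    linarith
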